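/- **Setting.** Let $\mathcal C=\{c_1,\dots,c_N\}$ be a finite set of constructors with arities, containing at least one constant, and let $\mathcal T(\mathcal C)$ be the set of closed terms over $\mathcal C$. Functions $f(x_1,\dots,x_k;y_1,\dots,y_l)$ on $\mathcal T(\mathcal C)$ have $k$ *normal* and $l$ *safe* arguments. The *general safe recursive* functions form the least class of total functions $f:\mathcal T(\mathcal C)^{k+l}\to\mathcal T(\mathcal C)$ containing - the constants $O^{k,l}_j(\vec x;\vec y)=c_j$ ($c_j$ a constant), the constructors $C_j(;\vec x)=c_j(\vec x)$ ($c_j$ not a constant), and all projections $I^{k,l}_j$; - the predecessors $P_{i,j}(;c_i(\vec x))=x_j$, and $P_{i,0}(;c_i)=c_i$ for a constant $c_i$, where terms whose root is another constructor are left unchanged; - the conditional $C(;c_j(\vec x),y_1,\dots,y_N)=y_j$; and closed under *safe composition* $f(\vec x;\vec y)=h(x_{j_1},\dots,x_{j_m};g_1(\vec x;\vec y),\dots,g_n(\vec x;\vec y))$ and *general safe recursion* $f(c_j(\vec x),\vec y;\vec z)=h_j(\vec x,\vec y;\vec z,f(x_1,\vec y;\vec z),\dots,f(x_{\mathrm{ar}(c_j)},\vec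 y;\vec z))$ for all $j\in\{1,\dots,N\}$. **Graphs.** A signature $\mathcal F=\mathcal C\cup\mathcal D$ is finite. Every symbol has normal argument positions followed by safe ones, and constructors have safe positions only. A *labeled graph* is a finite acyclic graph whose nodes are partially labeled by $\mathcal F$; a labeled node has an ordered list of successors, one for each argument position, and an unlabeled node (a variable) has none. A *term graph* is a labeled graph with a root from which every node is reachable. It is *closed* if all nodes are labeled, and *basic* if the root has a label in $\mathcal D$ and all labels below the root are in $\mathcal C$. $V_{G\restriction v}$ is the set of nodes reachable from $v$ in $G$, and $\mathrm{nrm}(v)$ the set of successors of $v$ at normal positions. A *rule* is a labeled graph $R$ with two distinct nodes $l,r$. A redex in $G$ is a rule together with a (not necessarily injective) homomorphism $\varphi:R\restriction l\to G$. It is contracted by adding copies of the nodes of $R\restriction r$ not in $R\restriction l$, redirecting all references to $\varphi(l)$ to the node corresponding to $r$, and removing unreachable nodes; results are taken up to isomorphism. A *GRS* $\mathcal G$ is a set of rules, and $\to_{\mathcal G}^m$ denotes $m$-step rewriting, under no strategy. $\mathcal G$ is a *constructor* GRS if in each rule the label of $l$ is in $\mathcal D$ and all other labels of $R\restriction l$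 are in $\mathcal C$. $\mathcal G$ is *safe recursive* if it consists of a (possibly infinite) set of rules of form (0) and a finite set of rules of forms (1) and (2); in (0) and (2) the nodes named are pairwise distinct and are all the nodes of the rule. - (0) *Safe recursive unfolding rules*: for disjoint $\Sigma,\Theta\subseteq\mathcal F$, a bijection $\theta:\Sigma\to\Theta$ with $\mathrm{ar}(\theta(g))=2\,\mathrm{ar}(g)+k+l$ for $g\in\Sigma$, and $f\in\mathcal F\setminus(\Sigma\cup\Theta)$ of arity $1+k+l$, the nodes are $y,v_1,\dots,v_m,w_1,\dots,w_m$ ($m\ge1$) and unlabeled $x_1,\dots,x_{k+l}$. The left root $y$ is $f(v_1,x_1,\dots,x_k;x_{k+1},\dots,x_{k+l})$ and the right root is $w_1$. Exactly $v_1,\dots,v_m$ are reachable from $v_1$. Whenever $v_j$ has label $g$ and successors $v_{j_1},\dots,v_{j_n}$, we have $g\in\Sigma$ and $w_j$ is $\theta(g)(v_{j_1},\dots,v_{j_n},x_1,\dots,x_k;x_{k+1},\dots,x_{k+l},w_{j_1},\dots,w_{j_n})$. - (1) Rules with $r\in V_{R\restriction l}\setminus\{l\}$. - (2) Rules $f(\vec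 x;\vec y)\to h(x_{j_1},\dots,x_{j_m};g_1(\vec x;\vec y),\dots,g_n(\vec x;\vec y))$ with pairwise distinct unlabeled nodes $\vec x,\vec y$, each shared between all its occurrences, and with one node for each of $f,h,g_1,\dots,g_n$. $\mathcal G$ *defines* $f$ if some $\mathsf f\in\mathcal D$ with $k$ normal and $l$ safe positions satisfies the following for all $\vec t,\vec s$ in $\mathcal T(\mathcal C)$ and every term graph $G$ whose term representation is $\mathsf f(\vec t;\vec s)$: (a) if $G\to_{\mathcal G}^*H$ and $H$ represents a term $q\in\mathcal T(\mathcal C)$, then $q=f(\vec t;\vec s)$; (b) if in addition each normal argument subgraph of $G$ is maximally shared (distinct nodes of it represent distinct terms), then $G$ rewrites to a graph representing $f(\vec t;\vec s)$, and every normal form of $G$ represents $f(\vec t;\vec s)$. **Corollary.** For every general safe recursive function $f$ over $\mathcal C$ there exist a finite signature $\mathcal F=\mathcal C\cup\mathcal D$, a constructor safe recursive GRS $\mathcal G$ over $\mathcal F$ defining $f$, and a polynomial $p:\mathbb N\to\mathbb N$ such that, for every closed basic term graph $G$ over $\mathcal F$, if $G\to_{\mathcal G}^m H$ for some term graph $H$,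 then $$m\le p\Bigl(\Bigl|\bigcup_{v\in \mathrm{nrm}(\mathrm{root}_G)}V_{G\restriction v}\Bigr|\Bigr).$$ -/

import Mathlib

namespace SafeGRS

/-! ### Constructor terms and general safe recursive functions

The constructors are enumerated as `c_0, …, c_{N-1}`, i.e. they are the elements of `Fin N`, and
`ar` gives their arities. -/

/-- Closed terms over the constructors. -/
inductive Tm {N : ℕ} (ar : Fin N → ℕ) : Type
  | app (c : Fin N) (ts : Fin (ar c) → Tm ar) : Tm ar

/-- The predecessor `P_{i,j}`: it maps `c_i (x_1, …, x_n)` to `x_j`. It is a total function: a term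
whose root symbol is another constructor is left unchanged. -/
def predFn {N : ℕ} {ar : Fin N → ℕ} (i : Fin N) (j : Fin (ar i)) : Tm ar → Tm ar
  | .app c ts => if h : c = i then ts (Fin.cast (congrArg ar h.symm) j) else .app c ts

/-- The conditional: it selects the branch of the root constructor of its first argument. -/
def condFn {N : ℕ} {ar : Fin N → ℕ} : Tm ar → (Fin N → Tm ar) → Tm ar
  | .app c _, ys => ys c

/-- `GSR ar k l f`: the function `f (x_1, …, x_k; y_1, …, y_l)` with `k` normal and `l` safe
arguments is general safe recursive. -/
inductive GSR {N : ℕ} (ar : Fin N → ℕ) :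
    (k l : ℕ) → ((Fin k → Tm ar) → (Fin l → Tm ar) → Tm ar) → Prop
  | constant (k l : ℕ) (c : Fin N) (h : ar c = 0) :
      GSR ar k l (fun _ _ => Tm.app c (fun i => (Fin.cast h i).elim0))
  | constructor (c : Fin N) (h : ar c ≠ 0) :
      GSR ar 0 (ar c) (fun _ y => Tm.app c y)
  | projNormal (k l : ℕ) (i : Fin k) : GSR ar k l (fun x _ => x i)
  | projSafe (k l : ℕ) (i : Fin l) : GSR ar k l (fun _ y => y i)
  /-- `P_{i,0} (; c_i) = c_i` for a constant `c_i`, other terms being left unchanged as well. -/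
  | predConstant (i : Fin N) (h : ar i = 0) : GSR ar 0 1 (fun _ y => y 0)
  | pred (i : Fin N) (j : Fin (ar i)) : GSR ar 0 1 (fun _ y => predFn i j (y 0))
  | conditional : GSR ar 0 (N + 1) (fun _ y => condFn (y 0) (fun c => y c.succ))
  | safeComposition {k l m n : ℕ}
      (h : (Fin m → Tm ar) → (Fin n → Tm ar) → Tm ar)
      (g : Fin n → (Fin k → Tm ar) → (Fin l → Tm ar) → Tm ar)
      (j : Fin m → Fin k) :
      GSR ar m n h → (∀ i, GSR ar k l (g i)) →
      GSR ar k l (fun x y => h (fun i => x (j i)) (fun i => g i x y))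
  | generalSafeRecursion {k l : ℕ}
      (h : (c : Fin N) → (Fin (ar c + k) → Tm ar) → (Fin (l + ar c) → Tm ar) → Tm ar)
      (f : (Fin (k + 1) → Tm ar) → (Fin l → Tm ar) → Tm ar) :
      (∀ c, GSR ar (ar c + k) (l + ar c) (h c)) →
      (∀ (c : Fin N) (x : Fin (ar c) → Tm ar) (y : Fin k → Tm ar) (z : Fin l → Tm ar),
        f (Fin.cons (Tm.app c x) y) z =
          h c (Fin.append x y) (Fin.append z (fun i => f (Fin.cons (x i) y) z))) →
      GSR ar (k + 1) l f

/-! ### Signatures and term graphs -/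

/-- A finite signature with argument separation that extends the given constructors: a finite set
`D` of defined symbols with their numbers of normal and of safe argument positions. -/
structure Signature {N : ℕ} (ar : Fin N → ℕ) where
  D : Type
  [finite : Finite D]
  nrm : D → ℕ
  safe : D → ℕ

namespace Signature

variable {N : ℕ} {ar : Fin N → ℕ} (σ : Signature ar)

/-- All function symbols: the constructors (`Sum.inl`) and the defined symbols (`Sum.inr`). -/
abbrev Sym : Type := Fin N ⊕ σ.D

/-- The number of normal argument positions; the normal positions precede the safe ones.
Constructors have safe argument positions only. -/
def nrmAr : σ.Sym → ℕ
  | .inl _ => 0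
  | .inr d => σ.nrm d

/-- The arity, i.e. the number of all argument positions. -/
def arity : σ.Sym → ℕ
  | .inl c => ar c
  | .inr d => σ.nrm d + σ.safe d

/-- The symbol is a constructor. -/
def IsCon (s : σ.Sym) : Prop := ∃ c, s = .inl c

/-- The symbol is a defined one. -/
def IsDef (s : σ.Sym) : Prop := ∃ d, s = .inr d

end Signature

/-- A finite acyclic labeled graph: `lab` is a partial labeling function and `succ v` is the list of
the successors of `v`. There is an edge from `u` to `v` iff `v` occurs in `succ u`. A node without
label stands for a free variable; it has no successors. -/
structure LGraph {N : ℕ} {ar : Fin N → ℕ} (σ : Signature ar) where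
  V : Type
  [finite : Finite V]
  lab : V → Option σ.Sym
  succ : V → List V
  length_succ : ∀ v s, lab v = some s → (succ v).length = σ.arity s
  succ_var : ∀ v, lab v = none → succ v = []
  acyclic : ∀ v, ¬ Relation.TransGen (fun a b => b ∈ succ a) v v

namespace LGraph

variable {N : ℕ} {ar : Fin N → ℕ} {σ : Signature ar} (G : LGraph σ)

/-- `v` is reachable from `u`, i.e. `v` is a node of the subgraph of `G` rooted at `u`. -/
def Reach (u v : G.V) : Prop := Relation.ReflTransGen (fun a b => b ∈ G.succ a) u v

/-- The labeling function is total. -/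
def Closed : Prop := ∀ v, G.lab v ≠ none

/-- The subgraph rooted at `v` is a graph over the constructors. -/
def ConAt (v : G.V) : Prop := ∀ u, G.Reach v u → ∀ s, G.lab u = some s → σ.IsCon s

/-- The successors of `v` at the normal argument positions. -/
def nrmSucc (v : G.V) : List G.V :=
  match G.lab v with
  | some s => (G.succ v).take (σ.nrmAr s)
  | none => []

/-- The term representation of the subgraph rooted at `v` is the constructor term `t`. -/
inductive Rep : G.V → Tm ar → Prop
  | mk (v : G.V) (c : Fin N) (us : Fin (ar c) → G.V) (ts : Fin (ar c) → Tm ar) :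
      G.lab v = some (.inl c) → G.succ v = List.ofFn us → (∀ i, Rep (us i) (ts i)) →
      Rep v (Tm.app c ts)

end LGraph

/-- A term graph: a labeled graph with a root from which every node is reachable. -/
structure TermGraph {N : ℕ} {ar : Fin N → ℕ} (σ : Signature ar) extends LGraph σ where
  root : V
  reach_root : ∀ v, toLGraph.Reach root v

namespace TermGraph

variable {N : ℕ} {ar : Fin N → ℕ} {σ : Signature ar} (G : TermGraph σ)

/-- A basic term graph: the root carries a defined symbol and all the argument subgraphs are graphs
over the constructors. -/
def Basic : Prop :=
  (∃ s, G.lab G.root = some s ∧ σ.IsDef s) ∧ ∀ v ∈ G.succ G.root, G.ConAt v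

/-- The number of nodes of the union of the subgraphs at the normal argument positions of the
root. -/
noncomputable def normalSize : ℕ :=
  Set.ncard {u : G.V | ∃ v ∈ G.nrmSucc G.root, G.Reach v u}

/-- `G` is a representation of `d (t_1, …, t_k; s_1, …, s_l)` (with arbitrary sharing). -/
def RepCall {k l : ℕ} (d : σ.D) (t : Fin k → Tm ar) (s : Fin l → Tm ar) : Prop :=
  G.lab G.root = some (.inr d) ∧
  ∃ (u : Fin k → G.V) (v : Fin l → G.V),
    G.succ G.root = List.ofFn u ++ List.ofFn v ∧
    (∀ i, G.Rep (u i) (t i)) ∧ (∀ i, G.Rep (v i) (s i))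

/-- Each normal argument subgraph is maximally shared: distinct nodes of it represent distinct
terms. -/
def NormalArgsShared : Prop :=
  ∀ v ∈ G.nrmSucc G.root, ∀ a b, G.Reach v a → G.Reach v b →
    ∀ t, G.Rep a t → G.Rep b t → a = b

end TermGraph

/-! ### Graph rewriting -/

/-- A graph rewrite rule: a labeled graph with two distinct nodes, the left and the right root. -/
structure Rule {N : ℕ} {ar : Fin N → ℕ} (σ : Signature ar) where
  G : LGraph σ
  l : G.V
  r : G.V
  ne : l ≠ r

section Rewriting

variable {N : ℕ} {ar : Fin N → ℕ} {σ : Signature ar}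

/-- `φ`, restricted to the nodes reachable from the left root, is a homomorphism from the left-hand
side of `ρ` to `G`; it need not be injective. The values of `φ` elsewhere are never used. -/
def IsMatch (ρ : Rule σ) (G : TermGraph σ) (φ : ρ.G.V → G.V) : Prop :=
  ∀ v, ρ.G.Reach ρ.l v → ∀ s, ρ.G.lab v = some s →
    G.lab (φ v) = some s ∧ G.succ (φ v) = (ρ.G.succ v).map φ

/-- The nodes of the right-hand side that do not belong to the left-hand side. -/
abbrev NewNode (ρ : Rule σ) : Type :=
  {v : ρ.G.V // ρ.G.Reach ρ.r v ∧ ¬ ρ.G.Reach ρ.l v}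

open Classical in
/-- Where a node of the rule is found after the build phase, which adds a copy of the new nodes. -/
noncomputable def place (ρ : Rule σ) (G : TermGraph σ) (φ : ρ.G.V → G.V) (v : ρ.G.V) :
    G.V ⊕ NewNode ρ :=
  if h : ρ.G.Reach ρ.r v ∧ ¬ ρ.G.Reach ρ.l v then .inr ⟨v, h⟩ else .inl (φ v)

open Classical in
/-- Redirection: each reference to the image of the left root becomes one to the right root. -/
noncomputable def redirect (ρ : Rule σ) (G : TermGraph σ) (φ : ρ.G.V → G.V)
    (x : G.V ⊕ NewNode ρ) : G.V ⊕ NewNode ρ :=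
  if x = .inl (φ ρ.l) then place ρ G φ ρ.r else x

/-- Labels after the build phase. -/
def builtLab (ρ : Rule σ) (G : TermGraph σ) : G.V ⊕ NewNode ρ → Option σ.Sym
  | .inl v => G.lab v
  | .inr v => ρ.G.lab v.1

/-- Successors after the build phase and redirection. -/
noncomputable def builtSucc (ρ : Rule σ) (G : TermGraph σ) (φ : ρ.G.V → G.V) :
    G.V ⊕ NewNode ρ → List (G.V ⊕ NewNode ρ)
  | .inl v => (G.succ v).map (fun u => redirect ρ G φ (.inl u))
  | .inr v => (ρ.G.succ v.1).map (fun u => redirect ρ G φ (place ρ G φ u))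

/-- `G` rewrites to `H` by the redex `(ρ, φ)`: up to isomorphism, `H` is what garbage collection
leaves of the graph built and redirected as above. Since every node of `H` is reachable from its
root, the image of the embedding `ψ` is precisely the part reachable from the new root. -/
def Contracts (ρ : Rule σ) (G H : TermGraph σ) (φ : ρ.G.V → G.V) : Prop :=
  ∃ ψ : H.V → G.V ⊕ NewNode ρ, Function.Injective ψ ∧
    ψ H.root = redirect ρ G φ (.inl G.root) ∧
    ∀ v, H.lab v = builtLab ρ G (ψ v) ∧ (H.succ v).map ψ = builtSucc ρ G φ (ψ v)

/-- One rewrite step in the graph rewrite system `S`. -/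
def Step (S : Set (Rule σ)) (G H : TermGraph σ) : Prop :=
  ∃ ρ ∈ S, ∃ φ : ρ.G.V → G.V, IsMatch ρ G φ ∧ Contracts ρ G H φ

/-- `Steps S m G H`: `G` rewrites to `H` in exactly `m` steps. -/
inductive Steps (S : Set (Rule σ)) : ℕ → TermGraph σ → TermGraph σ → Prop
  | refl (G : TermGraph σ) : Steps S 0 G G
  | tail {m : ℕ} {G H K : TermGraph σ} : Steps S m G H → Step S H K → Steps S (m + 1) G K

/-- `H` is in normal form. -/
def IsNormal (S : Set (Rule σ)) (H : TermGraph σ) : Prop := ∀ K, ¬ Step S H K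

/-! ### Safe recursive graph rewrite systems -/

/-- In every rule the left root carries a defined symbol and all the other labeled nodes of the
left-hand side carry constructors. -/
def IsConstructorGRS (S : Set (Rule σ)) : Prop :=
  ∀ ρ ∈ S, (∃ s, ρ.G.lab ρ.l = some s ∧ σ.IsDef s) ∧
    ∀ v, ρ.G.Reach ρ.l v → v ≠ ρ.l → ∀ s, ρ.G.lab v = some s → σ.IsCon s

/-- The nodes of an unfolding rule: `y`, `v_0, …, v_m`, `w_0, …, w_m`, the normal parameters
`x_0, …, x_{k-1}` and the safe parameters `z_0, …, z_{l-1}`. -/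
inductive UNode (m k l : ℕ) : Type
  | y : UNode m k l
  | v (i : Fin (m + 1)) : UNode m k l
  | w (i : Fin (m + 1)) : UNode m k l
  | x (i : Fin k) : UNode m k l
  | z (i : Fin l) : UNode m k l

/-- `ρ` is a safe recursive unfolding graph rewrite rule over `A` and `B` defining `f`, where `θ` is
the bijection from `A` to `B`. The list `a i` holds the indices of the successors of `v_i`. -/
def IsSafeUnfolding (ρ : Rule σ) : Prop :=
  ∃ (A B : Set σ.Sym) (θ : σ.Sym → σ.Sym) (f : σ.Sym) (m k l : ℕ)
    (e : UNode m k l ≃ ρ.G.V) (a : Fin (m + 1) → List (Fin (m + 1))),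
    Disjoint A B ∧ Set.BijOn θ A B ∧ f ∉ A ∪ B ∧
    σ.arity f = 1 + (k + l) ∧ (∀ g ∈ A, σ.arity (θ g) = 2 * σ.arity g + (k + l)) ∧
    ρ.l = e .y ∧ ρ.r = e (.w 0) ∧
    -- the node `y`: `f (v_0, x; z)`
    ρ.G.lab (e .y) = some f ∧ σ.nrmAr f = 1 + k ∧
    ρ.G.succ (e .y) =
      e (.v 0) :: (List.ofFn (fun i => e (.x i)) ++ List.ofFn (fun i => e (.z i))) ∧
    (∀ i, ρ.G.lab (e (.x i)) = none) ∧ (∀ i, ρ.G.lab (e (.z i)) = none) ∧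
    (∀ i, ρ.G.succ (e (.v i)) = (a i).map (fun j => e (.v j))) ∧
    (∀ u, ρ.G.Reach (e (.v 0)) u ↔ ∃ i, u = e (.v i)) ∧
    -- the nodes `w_i`: with `g` the label of `v_i`, `θ g (v_{a i}, x; z, w_{a i})`
    ∀ i, ∃ g ∈ A, ρ.G.lab (e (.v i)) = some g ∧ ρ.G.lab (e (.w i)) = some (θ g) ∧
      σ.nrmAr (θ g) = (a i).length + k ∧
      ρ.G.succ (e (.w i)) =
        ((a i).map (fun j => e (.v j)) ++ List.ofFn (fun j => e (.x j))) ++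
        (List.ofFn (fun j => e (.z j)) ++ (a i).map (fun j => e (.w j)))

/-- The right-hand side is a proper subgraph of the left-hand side. -/
def IsSubgraphRule (ρ : Rule σ) : Prop := ρ.G.Reach ρ.l ρ.r ∧ ρ.r ≠ ρ.l

/-- The nodes of a composition rule: `u`, `v`, the normal parameters `x_0, …, x_{k-1}`, the safe
parameters `z_0, …, z_{l-1}`, and `w_0, …, w_{n-1}`. -/
inductive CNode (k l n : ℕ) : Type
  | u : CNode k l n
  | v : CNode k l n
  | x (i : Fin k) : CNode k l n
  | z (i : Fin l) : CNode k l n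
  | w (i : Fin n) : CNode k l n

/-- The rule has the form `f (x; z) → h (x_{j_1}, …, x_{j_m}; g_1 (x; z), …, g_n (x; z))`. -/
def IsCompositionRule (ρ : Rule σ) : Prop :=
  ∃ (k l m n : ℕ) (e : CNode k l n ≃ ρ.G.V) (j : Fin m → Fin k)
    (f h : σ.Sym) (g : Fin n → σ.Sym),
    ρ.l = e .u ∧ ρ.r = e .v ∧
    (∀ i, ρ.G.lab (e (.x i)) = none) ∧ (∀ i, ρ.G.lab (e (.z i)) = none) ∧
    ρ.G.lab (e .u) = some f ∧ σ.nrmAr f = k ∧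
    ρ.G.succ (e .u) = List.ofFn (fun i => e (.x i)) ++ List.ofFn (fun i => e (.z i)) ∧
    ρ.G.lab (e .v) = some h ∧ σ.nrmAr h = m ∧
    ρ.G.succ (e .v) = List.ofFn (fun i => e (.x (j i))) ++ List.ofFn (fun i => e (.w i)) ∧
    ∀ i, ρ.G.lab (e (.w i)) = some (g i) ∧ σ.nrmAr (g i) = k ∧
      ρ.G.succ (e (.w i)) = List.ofFn (fun i => e (.x i)) ++ List.ofFn (fun i => e (.z i))

/-- A safe recursive graph rewrite system: a possibly infinite set of safe recursive unfolding rules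
together with finitely many subgraph rules and composition rules. -/
def IsSafeRecursiveGRS (S : Set (Rule σ)) : Prop :=
  {ρ ∈ S | ¬ IsSafeUnfolding ρ}.Finite ∧
  ∀ ρ ∈ S, IsSafeUnfolding ρ ∨ IsSubgraphRule ρ ∨ IsCompositionRule ρ

/-- `S` defines `f` through the symbol `d`. Rewriting a graph that represents `d (t; s)`, whatever
its sharing, never leads to a constructor term other than `f (t; s)`. If moreover the normal
arguments are represented with maximal sharing, then the graph rewrites to a representation of
`f (t; s)`, and so is each of its normal forms. -/
def Defines (S : Set (Rule σ)) (d : σ.D) {k l : ℕ}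
    (f : (Fin k → Tm ar) → (Fin l → Tm ar) → Tm ar) : Prop :=
  σ.nrm d = k ∧ σ.safe d = l ∧
  ∀ (G : TermGraph σ) (t : Fin k → Tm ar) (s : Fin l → Tm ar), G.RepCall d t s →
    (∀ H, Relation.ReflTransGen (Step S) G H → ∀ q, H.Rep H.root q → q = f t s) ∧
    (G.NormalArgsShared →
      (∃ H, Relation.ReflTransGen (Step S) G H ∧ H.Rep H.root (f t s)) ∧
      ∀ H, Relation.ReflTransGen (Step S) G H → IsNormal S H → H.Rep H.root (f t s))

end Rewriting

end SafeGRS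

open SafeGRS

/-! A derivation of a general safe recursive function is recorded as a `Code`, and its finitely many
constituents serve as defined symbols. Projections, predecessors and conditionals become subgraph
rules; constructors and safe composition become composition rules. Safe recursion becomes one
unfolding rule for each term `t`: its left-hand side contains the maximally shared graph of `t`, and
its right-hand side has one call of a step function for each distinct subterm of `t`.

Correctness rests on an invariant that needs no strategy. Values are assigned to all nodes
consistently with the interpretation of the symbols. Since both roots of a rule have the same value,
contraction preserves such an assignment together with the value of the root, whatever the sharing
(`Sound.exists_isModel`). Hence a constructor term that is reached can only be the intended value.

The step bound rests on a second invariant: a set `X` of constructor nodes contains every normal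
argument, and contraction never enlarges it (`NormalSet.contractum`, `IsContractum.ncard_le`),
because new nodes take their normal arguments from below those of the contracted node. So one number
`n`, the initial size of the normal arguments, bounds `X` for the whole derivation. A symbol weighs
`weight.eval n`: a composition weighs one more than the nodes that replace it. An unfolding adds at
most `n` nodes, since matches are injective on the subterm nodes (`unfRule_match_injective`), and
this explains the factor `X` in the weight of a recursion. The total weight drops at every step, and
in a basic graph only the root has positive weight.

Finally, if the normal arguments are maximally shared, sharing persists and every innermost defined
symbol has a redex (`hasRedexes_codeGRS`). Normal forms are then constructor graphs, and the step
bound guarantees that one is reached. -/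

namespace SafeGRS

open Polynomial

variable {N : ℕ} {ar : Fin N → ℕ}

/-! ### Constructor terms and their subterms -/

namespace Tm

/-- The root constructor of a term. -/
def head : Tm ar → Fin N
  | .app c _ => c

/-- The arguments of the root constructor of a term. -/
def args : (t : Tm ar) → Fin (ar t.head) → Tm ar
  | .app _ ts => ts

theorem app_head_args (t : Tm ar) : app t.head t.args = t := by
  cases t; rfl

/-- The number of symbol occurrences of a term. -/
def size : Tm ar → ℕ
  | .app _ ts => 1 + ∑ i, size (ts i)

theorem size_pos (t : Tm ar) : 0 < t.size := by
  cases t; simp [size]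

theorem size_args_lt (t : Tm ar) (i : Fin (ar t.head)) : (t.args i).size < t.size := by
  cases t with
  | app c ts =>
    have : (ts i).size ≤ ∑ i, (ts i).size :=
      Finset.single_le_sum (f := fun i => (ts i).size) (fun _ _ => Nat.zero_le _)
        (Finset.mem_univ i)
    change (ts i).size < 1 + ∑ i, (ts i).size
    omega

/-- The set of subterms of a term. -/
def subterms : Tm ar → Set (Tm ar)
  | .app c ts => insert (.app c ts) (⋃ i, subterms (ts i))

theorem self_mem_subterms (t : Tm ar) : t ∈ t.subterms := by
  cases t; simp [subterms]

theorem finite_subterms (t : Tm ar) : t.subterms.Finite := by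
  induction t with
  | app c ts ih => exact (Set.finite_iUnion ih).insert _

theorem args_mem_subterms {t s : Tm ar} (h : s ∈ t.subterms) (i : Fin (ar s.head)) :
    s.args i ∈ t.subterms := by
  induction t with
  | app c ts ih =>
    simp only [subterms, Set.mem_insert_iff, Set.mem_iUnion] at h ⊢
    rcases h with rfl | ⟨j, hj⟩
    · exact .inr ⟨i, self_mem_subterms _⟩
    · exact .inr ⟨j, ih j hj⟩

/-- Every subterm of `t` lies in each set that contains `t` and is closed under arguments. -/
theorem subterms_induction {t : Tm ar} {P : Tm ar → Prop} (ht : P t)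
    (step : ∀ s ∈ t.subterms, P s → ∀ i, P (s.args i)) : ∀ s ∈ t.subterms, P s := by
  induction t with
  | app c ts ih =>
    intro s hs
    simp only [subterms, Set.mem_insert_iff, Set.mem_iUnion] at hs
    rcases hs with rfl | ⟨j, hj⟩
    · exact ht
    · refine ih j (step _ (self_mem_subterms _) ht j) (fun s hs => step s ?_) s hj
      simp only [subterms, Set.mem_insert_iff, Set.mem_iUnion]
      exact .inr ⟨j, hs⟩

end Tm

/-! ### Codes of general safe recursive functions -/

/-- Syntax for the general safe recursive functions. -/
inductive Code (ar : Fin N → ℕ) : ℕ → ℕ → Type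
  | projNormal {k l : ℕ} (i : Fin k) : Code ar k l
  | projSafe {k l : ℕ} (i : Fin l) : Code ar k l
  | pred (i : Fin N) (j : Fin (ar i)) : Code ar 0 1
  | cond : Code ar 0 (N + 1)
  | con {k l : ℕ} (c : Fin N) (g : Fin (ar c) → Code ar k l) : Code ar k l
  | comp {k l m n : ℕ} (h : Code ar m n) (g : Fin n → Code ar k l) (j : Fin m → Fin k) :
      Code ar k l
  | recur {k l : ℕ} (h : (c : Fin N) → Code ar (ar c + k) (l + ar c)) : Code ar (k + 1) l

/-- The function defined by general safe recursion, in terms of its recursion argument. -/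
def recFn {k l : ℕ}
    (h : (c : Fin N) → (Fin (ar c + k) → Tm ar) → (Fin (l + ar c) → Tm ar) → Tm ar)
    (y : Fin k → Tm ar) (z : Fin l → Tm ar) : Tm ar → Tm ar
  | .app c ts => h c (Fin.append ts y) (Fin.append z (fun i => recFn h y z (ts i)))

namespace Code

/-- The function denoted by a code. -/
def sem : {k l : ℕ} → Code ar k l → (Fin k → Tm ar) → (Fin l → Tm ar) → Tm ar
  | _, _, .projNormal i => fun x _ => x i
  | _, _, .projSafe i => fun _ y => y i
  | _, _, .pred i j => fun _ y => predFn i j (y 0)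
  | _, _, .cond => fun _ y => condFn (y 0) (fun c => y c.succ)
  | _, _, .con c g => fun x y => .app c (fun i => (g i).sem x y)
  | _, _, .comp h g j => fun x y => h.sem (fun i => x (j i)) (fun i => (g i).sem x y)
  | _, _, .recur h => fun x z => recFn (fun c => (h c).sem) (Fin.tail x) z (x 0)

/-- A polynomial bound on the number of steps caused by one node labeled with the code. -/
noncomputable def weight : {k l : ℕ} → Code ar k l → ℕ[X]
  | _, _, .projNormal _ => 1
  | _, _, .projSafe _ => 1
  | _, _, .pred _ _ => 1
  | _, _, .cond => 1
  | _, _, .con _ g => 1 + ∑ i, (g i).weight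
  | _, _, .comp h g _ => 1 + (h.weight + ∑ i, (g i).weight)
  | _, _, .recur h => 1 + X * ∑ c, (h c).weight

end Code

/-- Symbols and weights have to be computed from a derivation, so the inductive predicate is
replaced by data. The predecessor of a constant is the identity, hence a projection, and the
recursion equations determine the function by induction on the recursion argument. -/
theorem GSR.exists_code {k l : ℕ} {f : (Fin k → Tm ar) → (Fin l → Tm ar) → Tm ar}
    (hf : GSR ar k l f) : ∃ e : Code ar k l, e.sem = f := by
  induction hf with
  | constant k l c h =>
    refine ⟨.con c (fun i => (Fin.cast h i).elim0), ?_⟩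
    funext x y
    simp only [Code.sem]
    congr 1
    funext i
    exact (Fin.cast h i).elim0
  | constructor c h => exact ⟨.con c (fun i => .projSafe i), rfl⟩
  | projNormal k l i => exact ⟨.projNormal i, rfl⟩
  | projSafe k l i => exact ⟨.projSafe i, rfl⟩
  | predConstant i h => exact ⟨.projSafe 0, rfl⟩
  | pred i j => exact ⟨.pred i j, rfl⟩
  | conditional => exact ⟨.cond, rfl⟩
  | safeComposition h g j _ _ ihh ihg =>
    obtain ⟨eh, rfl⟩ := ihh
    choose eg heg using ihg
    obtain rfl : (fun i => (eg i).sem) = g := funext heg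
    exact ⟨.comp eh eg j, rfl⟩
  | generalSafeRecursion h f _ hrec ihh =>
    choose eh heh using ihh
    obtain rfl : (fun c => (eh c).sem) = h := funext heh
    refine ⟨.recur eh, ?_⟩
    funext x z
    obtain ⟨a, y, rfl⟩ : ∃ a y, x = Fin.cons a y := ⟨x 0, Fin.tail x, (Fin.cons_self_tail x).symm⟩
    simp only [Code.sem, Fin.tail_cons, Fin.cons_zero]
    induction a with
    | app c ts ih => rw [hrec, recFn]; simp only [ih]

/-- Codes with their numbers of normal and safe arguments. -/
abbrev AnyCode (ar : Fin N → ℕ) : Type := Σ k l : ℕ, Code ar k l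

/-- The immediate constituents of a code. -/
def AnyCode.children : AnyCode ar → Set (AnyCode ar)
  | ⟨_, _, .con _ g⟩ => Set.range fun i => ⟨_, _, g i⟩
  | ⟨_, _, .comp h g _⟩ => insert ⟨_, _, h⟩ (Set.range fun i => ⟨_, _, g i⟩)
  | ⟨_, _, .recur h⟩ => Set.range fun c => ⟨_, _, h c⟩
  | _ => ∅

/-- All constituents of a code. -/
def AnyCode.parts (e : AnyCode ar) : Set (AnyCode ar) :=
  {e' | Relation.ReflTransGen (fun a b => b ∈ AnyCode.children a) e e'}

theorem AnyCode.parts_eq (e : AnyCode ar) : e.parts = insert e (⋃ b ∈ e.children, b.parts) := by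
  ext x
  simp only [parts, Set.mem_ofPred_eq, Set.mem_insert_iff, Set.mem_iUnion, exists_prop]
  rw [Relation.ReflTransGen.cases_head_iff, eq_comm]

theorem AnyCode.finite_parts (e : AnyCode ar) : e.parts.Finite := by
  obtain ⟨k, l, e⟩ := e
  induction e with
  | con c g ih | recur g ih =>
    rw [parts_eq, children, Set.biUnion_range]
    exact (Set.finite_iUnion ih).insert _
  | comp h g j ihh ihg =>
    rw [parts_eq, children, Set.biUnion_insert, Set.biUnion_range]
    exact (ihh.union (Set.finite_iUnion ihg)).insert _
  | _ =>
    rw [parts_eq]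
    simp [children]

theorem AnyCode.children_subset_parts {e a b : AnyCode ar} (ha : a ∈ e.parts)
    (hb : b ∈ a.children) : b ∈ e.parts :=
  Relation.ReflTransGen.tail ha hb

end SafeGRS

namespace SafeGRS

variable {N : ℕ} {ar : Fin N → ℕ} {σ : Signature ar}

/-! ### Rank, reachability and term representation in labeled graphs -/

namespace LGraph

variable (G : LGraph σ)

theorem nrmSucc_of_lab {v : G.V} {s : σ.Sym} (h : G.lab v = some s) :
    G.nrmSucc v = (G.succ v).take (σ.nrmAr s) := by
  simp [nrmSucc, h]

theorem mem_succ_of_mem_nrmSucc {u v : G.V} (h : u ∈ G.nrmSucc v) : u ∈ G.succ v := by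
  unfold nrmSucc at h
  split at h
  · exact List.mem_of_mem_take h
  · simp at h

theorem nrmSucc_of_isCon {v : G.V} (h : ∀ s, G.lab v = some s → σ.IsCon s) : G.nrmSucc v = [] := by
  unfold nrmSucc
  split
  · next s hs =>
    obtain ⟨c, rfl⟩ := h s hs
    simp [Signature.nrmAr]
  · rfl

theorem exists_lab_of_mem_succ {u v : G.V} (h : u ∈ G.succ v) : ∃ s, G.lab v = some s := by
  cases hs : G.lab v with
  | none => simp [G.succ_var v hs] at h
  | some s => exact ⟨s, rfl⟩

/-- A cycle would be an infinite descent of the rank. All rule graphs and contracta are shown to be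
acyclic in this way. -/
theorem acyclic_of_rank {V : Type} {succ : V → List V} {β : Type*} {r : β → β → Prop}
    (hr : WellFounded r) (rank : V → β) (h : ∀ v, ∀ u ∈ succ v, r (rank u) (rank v)) (v : V) :
    ¬ Relation.TransGen (fun a b => b ∈ succ a) v v := by
  intro hv
  have key : ∀ {a b}, Relation.TransGen (fun a b => b ∈ succ a) a b →
      Relation.TransGen r (rank b) (rank a) := by
    intro a b hab
    induction hab with
    | single h1 => exact .single (h _ _ h1)
    | tail _ h1 ih => exact .head (h _ _ h1) ih
  exact hr.transGen.irrefl.irrefl _ (key hv)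

/-- The number of nodes below a node. -/
noncomputable def rank (v : G.V) : ℕ :=
  Set.ncard {u | Relation.TransGen (fun a b => b ∈ G.succ a) v u}

theorem rank_lt {u v : G.V} (h : Relation.TransGen (fun a b => b ∈ G.succ a) v u) :
    G.rank u < G.rank v := by
  have := G.finite
  refine Set.ncard_lt_ncard ?_ (Set.toFinite _)
  refine ⟨fun w hw => h.trans hw, fun hsub => G.acyclic u (hsub ?_)⟩
  exact h

theorem rank_lt_of_mem_succ {u v : G.V} (h : u ∈ G.succ v) : G.rank u < G.rank v :=
  G.rank_lt (.single h)

/-- A set of nodes that is closed under successors. -/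
def IsClosedSet (X : Set G.V) : Prop := ∀ v ∈ X, ∀ u ∈ G.succ v, u ∈ X

theorem IsClosedSet.reach {G : LGraph σ} {X : Set G.V} (hX : G.IsClosedSet X) {u v : G.V}
    (hu : u ∈ X) (h : G.Reach u v) : v ∈ X := by
  induction h with
  | refl => exact hu
  | tail _ h ih => exact hX _ ih _ h

theorem Reach.succ_of_ne {G : LGraph σ} {u v : G.V} (h : G.Reach u v) (hne : v ≠ u) :
    ∃ w ∈ G.succ u, G.Reach w v := by
  rcases Relation.ReflTransGen.cases_head h with rfl | ⟨w, hw, hr⟩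
  · exact absurd rfl hne
  · exact ⟨w, hw, hr⟩

theorem Rep.unique {G : LGraph σ} {v : G.V} {t t' : Tm ar} (h : G.Rep v t) (h' : G.Rep v t') :
    t = t' := by
  induction h generalizing t' with
  | mk v c us ts hl hs _ ih =>
    cases h' with
    | mk _ c' us' ts' hl' hs' hr' =>
      obtain rfl : c = c' := by simpa [hl] using hl'
      obtain rfl : us = us' := List.ofFn_injective (hs.symm.trans hs')
      rw [funext fun i => ih i (hr' i)]

theorem Rep.of_reach {G : LGraph σ} {v u : G.V} {t : Tm ar} (h : G.Rep v t) (hu : G.Reach v u) :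
    ∃ t', G.Rep u t' := by
  induction hu with
  | refl => exact ⟨t, h⟩
  | tail _ hbc ih =>
    obtain ⟨t', ht'⟩ := ih
    cases ht' with
    | mk _ c us ts hl hs hr =>
      rw [hs, List.mem_ofFn] at hbc
      obtain ⟨i, rfl⟩ := hbc
      exact ⟨_, hr i⟩

theorem Rep.conAt {G : LGraph σ} {v : G.V} {t : Tm ar} (h : G.Rep v t) : G.ConAt v := by
  intro u hu s hs
  obtain ⟨t', ht'⟩ := h.of_reach hu
  cases ht' with
  | mk _ c us ts hl _ _ => exact ⟨c, by simpa [hs] using hl⟩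

end LGraph

/-! ### Contractions -/

section Contraction

variable {ρ : Rule σ} {G H : TermGraph σ} {φ : ρ.G.V → G.V}

theorem IsMatch.mem_succ (hm : IsMatch ρ G φ) {a b : ρ.G.V} (ha : ρ.G.Reach ρ.l a)
    (hb : b ∈ ρ.G.succ a) : φ b ∈ G.succ (φ a) := by
  obtain ⟨s, hs⟩ := ρ.G.exists_lab_of_mem_succ hb
  rw [(hm a ha s hs).2]
  exact List.mem_map_of_mem hb

theorem IsMatch.transGen (hm : IsMatch ρ G φ) {v : ρ.G.V} (hv : ρ.G.Reach ρ.l v)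
    (hne : v ≠ ρ.l) : Relation.TransGen (fun a b => b ∈ G.succ a) (φ ρ.l) (φ v) := by
  rcases Relation.reflTransGen_iff_eq_or_transGen.1 hv with rfl | h
  · exact absurd rfl hne
  · clear hne hv
    induction h with
    | single h => exact .single (hm.mem_succ .refl h)
    | tail h h1 ih => exact .tail ih (hm.mem_succ h.to_reflTransGen h1)

theorem place_of_new {v : ρ.G.V} (h : ρ.G.Reach ρ.r v ∧ ¬ ρ.G.Reach ρ.l v) :
    place ρ G φ v = .inr ⟨v, h⟩ := by
  simp [place, h]

theorem place_of_reach {v : ρ.G.V} (h : ρ.G.Reach ρ.l v) : place ρ G φ v = .inl (φ v) := by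
  simp [place, h]

theorem redirect_of_ne {x : G.V ⊕ NewNode ρ} (h : x ≠ .inl (φ ρ.l)) : redirect ρ G φ x = x := by
  simp [redirect, h]

theorem redirect_left : redirect ρ G φ (.inl (φ ρ.l)) = place ρ G φ ρ.r := by
  simp [redirect]

/-- If the right root belongs to the left-hand side, it lies strictly below the left root, and so do
their images. Hence acyclicity of `G` separates the images although `φ` need not be injective. -/
theorem IsMatch.place_right_ne (hm : IsMatch ρ G φ) :
    place ρ G φ ρ.r ≠ .inl (φ ρ.l) := by
  by_cases h : ρ.G.Reach ρ.l ρ.r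
  · rw [place_of_reach h]
    intro he
    have := hm.transGen h ρ.ne.symm
    rw [Sum.inl_injective he] at this
    exact G.acyclic _ this
  · rw [place_of_new ⟨.refl, h⟩]
    simp

theorem IsMatch.redirect_ne (hm : IsMatch ρ G φ) (x : G.V ⊕ NewNode ρ) :
    redirect ρ G φ x ≠ .inl (φ ρ.l) := by
  by_cases h : x = .inl (φ ρ.l)
  · rw [h, redirect_left]
    exact hm.place_right_ne
  · rwa [redirect_of_ne h]

/-- The embedding `ψ` exhibits `H` as the contractum of the redex `(ρ, φ)` in `G`. -/
structure IsContractum (ρ : Rule σ) (G H : TermGraph σ) (φ : ρ.G.V → G.V)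
    (ψ : H.V → G.V ⊕ NewNode ρ) : Prop where
  injective : Function.Injective ψ
  root : ψ H.root = redirect ρ G φ (.inl G.root)
  lab : ∀ v, H.lab v = builtLab ρ G (ψ v)
  succ : ∀ v, (H.succ v).map ψ = builtSucc ρ G φ (ψ v)

theorem Contracts.exists_isContractum (h : Contracts ρ G H φ) :
    ∃ ψ, IsContractum ρ G H φ ψ :=
  let ⟨ψ, h1, h2, h3⟩ := h
  ⟨ψ, h1, h2, fun v => (h3 v).1, fun v => (h3 v).2⟩

variable {ψ : H.V → G.V ⊕ NewNode ρ}

/-- After redirection neither the root nor any edge points to the contracted node, so it is always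
garbage. This is what pays for a step in the weight count. -/
theorem IsContractum.ne_left (hc : IsContractum ρ G H φ ψ) (hm : IsMatch ρ G φ) (v : H.V) :
    ψ v ≠ .inl (φ ρ.l) := by
  rcases Relation.ReflTransGen.cases_tail (H.reach_root v) with h | ⟨u, _, h⟩
  · rw [h, hc.root]
    exact hm.redirect_ne _
  · have h' : ψ v ∈ builtSucc ρ G φ (ψ u) := by
      rw [← hc.succ]
      exact List.mem_map_of_mem h
    cases hu : ψ u <;> rw [hu] at h' <;> simp only [builtSucc, List.mem_map] at h' <;>
    · obtain ⟨w, _, hw⟩ := h'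
      rw [← hw]
      exact hm.redirect_ne _

/-! ### Models -/

/-- `α` assigns values to the nodes of `G` that are consistent with the interpretation `R` of the
function symbols as relations between argument lists and values. -/
def IsModel (R : σ.Sym → List (Tm ar) → Tm ar → Prop) (G : LGraph σ) (α : G.V → Tm ar) : Prop :=
  ∀ v, ∃ s, G.lab v = some s ∧ R s ((G.succ v).map α) (α v)

/-- Values for the left-hand side of the rule can be extended to the right-hand side in such a way
that both roots have the same value. -/
def Sound (R : σ.Sym → List (Tm ar) → Tm ar → Prop) (ρ : Rule σ) : Prop :=
  ∀ α : ρ.G.V → Tm ar,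
    (∀ v, ρ.G.Reach ρ.l v → ∀ s, ρ.G.lab v = some s → R s ((ρ.G.succ v).map α) (α v)) →
    ∃ β : ρ.G.V → Tm ar, (∀ v, ρ.G.Reach ρ.l v → β v = α v) ∧
      (∀ v, ρ.G.Reach ρ.r v → ¬ ρ.G.Reach ρ.l v →
        ∃ s, ρ.G.lab v = some s ∧ R s ((ρ.G.succ v).map β) (β v)) ∧
      β ρ.l = β ρ.r

/-- Values of old nodes are kept and new nodes take theirs from the rule. Redirection exchanges two
nodes of equal value, so every argument list keeps its values. -/
theorem Sound.exists_isModel {R : σ.Sym → List (Tm ar) → Tm ar → Prop} (hs : Sound R ρ)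
    (hm : IsMatch ρ G φ) (hc : IsContractum ρ G H φ ψ) {α : G.V → Tm ar}
    (hα : IsModel R G.toLGraph α) :
    ∃ α' : H.V → Tm ar, IsModel R H.toLGraph α' ∧ α' H.root = α G.root ∧
      ∀ v x, ψ v = .inl x → α' v = α x := by
  obtain ⟨β, h1, h2, h3⟩ := hs (α ∘ φ) (by
    intro v hv s hs
    obtain ⟨s', hs', hR⟩ := hα (φ v)
    obtain ⟨hl, hsu⟩ := hm v hv s hs
    obtain rfl : s = s' := by simpa [hl] using hs'
    rwa [hsu, List.map_map] at hR)
  set γ : G.V ⊕ NewNode ρ → Tm ar := Sum.elim α (fun w => β w.1) with hγ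
  have hplace : ∀ v, ρ.G.Reach ρ.r v → γ (place ρ G φ v) = β v := by
    intro v hv
    by_cases h : ρ.G.Reach ρ.l v
    · rw [place_of_reach h, h1 v h]; rfl
    · rw [place_of_new ⟨hv, h⟩]; rfl
  have hred : ∀ x, γ (redirect ρ G φ x) = γ x := by
    intro x
    by_cases h : x = .inl (φ ρ.l)
    · rw [h, redirect_left, hplace _ .refl, ← h3, h1 _ .refl]; rfl
    · rw [redirect_of_ne h]
  refine ⟨γ ∘ ψ, ?_, ?_, ?_⟩
  · intro v
    rw [← List.map_map, hc.lab, hc.succ]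
    cases hv : ψ v with
    | inl x =>
      obtain ⟨s, hs, hR⟩ := hα x
      refine ⟨s, hs, ?_⟩
      have : (builtSucc ρ G φ (.inl x)).map γ = (G.succ x).map α := by
        simp only [builtSucc, List.map_map]
        exact List.map_congr_left fun u _ => hred _
      rw [this]
      simpa [hv, hγ] using hR
    | inr w =>
      obtain ⟨s, hs, hR⟩ := h2 w.1 w.2.1 w.2.2
      refine ⟨s, hs, ?_⟩
      have : (builtSucc ρ G φ (.inr w)).map γ = (ρ.G.succ w.1).map β := by
        simp only [builtSucc, List.map_map]
        refine List.map_congr_left fun u hu => ?_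
        simp only [Function.comp, hred]
        exact hplace u (w.2.1.tail hu)
      rw [this]
      simpa [hv, hγ] using hR
  · rw [Function.comp, hc.root, hred]; rfl
  · intro v x hv
    simp [hv, hγ]

/-! ### Normal arguments -/

/-- `X` is a set of constructor nodes that contains all normal arguments. -/
structure NormalSet (G : LGraph σ) (X : Set G.V) : Prop where
  closed : G.IsClosedSet X
  con : ∀ v ∈ X, ∀ s, G.lab v = some s → σ.IsCon s
  nrm : ∀ v, ∀ u ∈ G.nrmSucc v, u ∈ X

/-- All normal arguments on the right-hand side are nodes of normal arguments of the left root. -/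
def NormalRule (ρ : Rule σ) : Prop :=
  ∀ w, ρ.G.Reach ρ.r w → ¬ ρ.G.Reach ρ.l w → ∀ b ∈ ρ.G.nrmSucc w,
    ∃ a ∈ ρ.G.nrmSucc ρ.l, ρ.G.Reach a b

theorem IsMatch.mem_nrmSucc (hm : IsMatch ρ G φ) {a : ρ.G.V} (ha : a ∈ ρ.G.nrmSucc ρ.l) :
    φ a ∈ G.nrmSucc (φ ρ.l) := by
  obtain ⟨s, hs⟩ := ρ.G.exists_lab_of_mem_succ (ρ.G.mem_succ_of_mem_nrmSucc ha)
  obtain ⟨hl, hsu⟩ := hm _ .refl s hs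
  rw [LGraph.nrmSucc_of_lab _ hs] at ha
  rw [LGraph.nrmSucc_of_lab _ hl, hsu, ← List.map_take]
  exact List.mem_map_of_mem ha

theorem IsMatch.mem_closed_of_nrmSucc (hm : IsMatch ρ G φ) {X : Set G.V}
    (hX : NormalSet G.toLGraph X) {a b : ρ.G.V} (ha : a ∈ ρ.G.nrmSucc ρ.l)
    (hb : ρ.G.Reach a b) : φ b ∈ X := by
  have hla : ρ.G.Reach ρ.l a := .single (ρ.G.mem_succ_of_mem_nrmSucc ha)
  induction hb with
  | refl => exact hX.nrm _ _ (hm.mem_nrmSucc ha)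
  | tail h1 h2 ih => exact hX.closed _ ih _ (hm.mem_succ (hla.trans h1) h2)

theorem NormalSet.left_notMem {X : Set G.V} (hX : NormalSet G.toLGraph X) (hm : IsMatch ρ G φ)
    {d : σ.D} (hd : ρ.G.lab ρ.l = some (.inr d)) : φ ρ.l ∉ X := by
  intro h
  obtain ⟨c, hc⟩ := hX.con _ h _ (hm _ .refl _ hd).1
  simp at hc

/-- The contracted node carries a defined symbol and so lies outside `X`; redirection leaves the
edges inside `X` alone. -/
theorem IsContractum.mem_succ_of_old (hc : IsContractum ρ G H φ ψ) {X : Set G.V}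
    (hX : NormalSet G.toLGraph X) (hm : IsMatch ρ G φ)
    {d : σ.D} (hd : ρ.G.lab ρ.l = some (.inr d)) {v u : H.V} {x : G.V} (hx : x ∈ X)
    (hv : ψ v = .inl x) (hu : u ∈ H.succ v) : ∃ y ∈ G.succ x, ψ u = .inl y := by
  have h : ψ u ∈ builtSucc ρ G φ (ψ v) := by
    rw [← hc.succ]
    exact List.mem_map_of_mem hu
  rw [hv] at h
  simp only [builtSucc, List.mem_map] at h
  obtain ⟨y, hy, h⟩ := h
  refine ⟨y, hy, ?_⟩
  rw [← h, redirect_of_ne]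
  intro he
  exact hX.left_notMem hm hd (Sum.inl_injective he ▸ hX.closed x hx y hy)

/-- What survives of `X` still suffices: normal arguments of old nodes are in `X` and are not
redirected, and those of new nodes are images of nodes below normal arguments of the left root. No
new node enters the set. -/
theorem NormalSet.contractum {X : Set G.V} (hX : NormalSet G.toLGraph X) (hm : IsMatch ρ G φ)
    {d : σ.D} (hd : ρ.G.lab ρ.l = some (.inr d)) (hn : NormalRule ρ)
    (hc : IsContractum ρ G H φ ψ) : NormalSet H.toLGraph {v | ∃ x ∈ X, ψ v = .inl x} where
  closed := by
    rintro v ⟨x, hx, hv⟩ u hu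
    obtain ⟨y, hy, h⟩ := hc.mem_succ_of_old hX hm hd hx hv hu
    exact ⟨y, hX.closed x hx y hy, h⟩
  con := by
    rintro v ⟨x, hx, hv⟩ s hs
    rw [hc.lab, hv] at hs
    exact hX.con x hx s hs
  nrm := by
    intro v u hu
    have hred : ∀ y ∈ X, redirect ρ G φ (.inl y) = .inl y := fun y hy =>
      redirect_of_ne fun he => hX.left_notMem hm hd (Sum.inl_injective he ▸ hy)
    obtain ⟨s, hs⟩ := H.exists_lab_of_mem_succ (H.mem_succ_of_mem_nrmSucc hu)
    rw [LGraph.nrmSucc_of_lab _ hs] at hu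
    have hu' := List.mem_map_of_mem (f := ψ) hu
    rw [List.map_take, hc.succ] at hu'
    rw [hc.lab] at hs
    cases hv : ψ v with
    | inl x =>
      rw [hv] at hu' hs
      simp only [builtSucc, ← List.map_take, List.mem_map] at hu'
      obtain ⟨y, hy, h⟩ := hu'
      rw [← LGraph.nrmSucc_of_lab G.toLGraph hs] at hy
      have hyX := hX.nrm _ _ hy
      exact ⟨y, hyX, by rw [← h, hred y hyX]⟩
    | inr w =>
      rw [hv] at hu' hs
      simp only [builtSucc, ← List.map_take, List.mem_map] at hu'
      obtain ⟨b, hb, h⟩ := hu'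
      rw [← LGraph.nrmSucc_of_lab ρ.G hs] at hb
      obtain ⟨a, ha, hab⟩ := hn w.1 w.2.1 w.2.2 b hb
      have hyX := hm.mem_closed_of_nrmSucc hX ha hab
      have hlb : ρ.G.Reach ρ.l b :=
        Relation.ReflTransGen.head (ρ.G.mem_succ_of_mem_nrmSucc ha) hab
      exact ⟨_, hyX, by rw [← h, place_of_reach hlb, hred _ hyX]⟩

theorem IsContractum.ncard_le (hc : IsContractum ρ G H φ ψ) (X : Set G.V) :
    Set.ncard {v | ∃ x ∈ X, ψ v = .inl x} ≤ X.ncard := by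
  have := G.finite
  have := H.finite
  rw [← Set.ncard_image_of_injective _ hc.injective,
    ← Set.ncard_image_of_injective X (Sum.inl_injective (β := NewNode ρ))]
  have : Finite (NewNode ρ) := by
    have := ρ.G.finite
    infer_instance
  refine Set.ncard_le_ncard ?_ (Set.toFinite _)
  rintro _ ⟨v, ⟨x, hx, hv⟩, rfl⟩
  exact ⟨x, hx, hv.symm⟩

theorem IsContractum.reach_old (hc : IsContractum ρ G H φ ψ) {X : Set G.V}
    (hX : NormalSet G.toLGraph X) (hm : IsMatch ρ G φ)
    {d : σ.D} (hd : ρ.G.lab ρ.l = some (.inr d)) {v u : H.V} {x : G.V} (hx : x ∈ X)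
    (hv : ψ v = .inl x) (hu : H.Reach v u) : ∃ y, G.Reach x y ∧ ψ u = .inl y := by
  induction hu with
  | refl => exact ⟨x, .refl, hv⟩
  | tail _ h ih =>
    obtain ⟨y, hy, hψ⟩ := ih
    obtain ⟨z, hz, hψ'⟩ := hc.mem_succ_of_old hX hm hd (hX.closed.reach hx hy) hψ h
    exact ⟨z, hy.tail hz, hψ'⟩

/-- Below each node of `X`, distinct nodes have distinct values. -/
def SharedOn (G : LGraph σ) (α : G.V → Tm ar) (X : Set G.V) : Prop :=
  ∀ x ∈ X, ∀ a b, G.Reach x a → G.Reach x b → α a = α b → a = b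

/-- Paths that start in the surviving part of `X` are paths of `G`, and values there are unchanged,
so a violation of sharing would already occur in `G`. -/
theorem SharedOn.contractum {X : Set G.V} (hX : NormalSet G.toLGraph X) (hm : IsMatch ρ G φ)
    {d : σ.D} (hd : ρ.G.lab ρ.l = some (.inr d)) (hc : IsContractum ρ G H φ ψ)
    {α : G.V → Tm ar} {α' : H.V → Tm ar} (hα : ∀ v x, ψ v = .inl x → α' v = α x)
    (hs : SharedOn G.toLGraph α X) : SharedOn H.toLGraph α' {v | ∃ x ∈ X, ψ v = .inl x} := by
  rintro v ⟨x, hx, hv⟩ a b ha hb hab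
  obtain ⟨a', ha', hψa⟩ := hc.reach_old hX hm hd hx hv ha
  obtain ⟨b', hb', hψb⟩ := hc.reach_old hX hm hd hx hv hb
  rw [hα _ _ hψa, hα _ _ hψb] at hab
  exact hc.injective (by rw [hψa, hψb, hs x hx a' b' ha' hb' hab])

/-! ### Weights -/

/-- The total weight of the nodes of a graph. -/
noncomputable def weightSum (w : Option σ.Sym → ℕ) (G : LGraph σ) : ℕ :=
  haveI := G.finite
  haveI := Fintype.ofFinite G.V
  ∑ v, w (G.lab v)

/-- The total weight of the nodes that a contraction adds. -/
noncomputable def newWeight (w : Option σ.Sym → ℕ) (ρ : Rule σ) : ℕ :=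
  haveI := ρ.G.finite
  haveI := Fintype.ofFinite (NewNode ρ)
  ∑ v : NewNode ρ, w (ρ.G.lab v.1)

/-- `H` embeds into the old and new nodes and misses the contracted one. -/
theorem IsContractum.weightSum_le (hc : IsContractum ρ G H φ ψ) (hm : IsMatch ρ G φ)
    (w : Option σ.Sym → ℕ) :
    weightSum w H.toLGraph + w (G.lab (φ ρ.l)) ≤ weightSum w G.toLGraph + newWeight w ρ := by
  classical
  have := G.finite
  have := H.finite
  have := ρ.G.finite
  let _ := Fintype.ofFinite G.V
  let _ := Fintype.ofFinite H.V
  let _ := Fintype.ofFinite (NewNode ρ)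
  have e1 : weightSum w G.toLGraph + newWeight w ρ =
      ∑ x : G.V ⊕ NewNode ρ, w (builtLab ρ G x) := by
    rw [Fintype.sum_sum_type]; rfl
  have e2 : weightSum w H.toLGraph = ∑ x ∈ Finset.univ.image ψ, w (builtLab ρ G x) := by
    rw [Finset.sum_image fun a _ b _ h => hc.injective h]
    exact Finset.sum_congr rfl fun v _ => by rw [hc.lab]
  have hn : .inl (φ ρ.l) ∉ Finset.univ.image ψ := by
    simp only [Finset.mem_image, not_exists, not_and]
    exact fun v _ => hc.ne_left hm v
  have e3 : w (G.lab (φ ρ.l)) = w (builtLab ρ G (.inl (φ ρ.l))) := rfl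
  rw [e1, e2, e3, add_comm,
    ← Finset.sum_insert (f := fun x => w (builtLab ρ G x)) hn]
  exact Finset.sum_le_sum_of_subset (Finset.subset_univ _)

theorem newWeight_le (w : Option σ.Sym → ℕ) (ρ : Rule σ) {ι : Type} [Fintype ι]
    (node : ι → ρ.G.V) (h : ∀ v, ρ.G.Reach ρ.r v → ¬ ρ.G.Reach ρ.l v → ∃ i, node i = v) :
    newWeight w ρ ≤ ∑ i, w (ρ.G.lab (node i)) := by
  classical
  have := ρ.G.finite
  let _ := Fintype.ofFinite (NewNode ρ)
  choose g hg using fun v : NewNode ρ => h v.1 v.2.1 v.2.2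
  have hinj : Function.Injective g := fun a b hab => Subtype.ext (by rw [← hg a, ← hg b, hab])
  calc newWeight w ρ = ∑ v : NewNode ρ, w (ρ.G.lab (node (g v))) :=
        Finset.sum_congr rfl fun v _ => by rw [hg]
    _ = ∑ i ∈ Finset.univ.image g, w (ρ.G.lab (node i)) :=
        (Finset.sum_image (f := fun i => w (ρ.G.lab (node i))) fun a _ b _ h => hinj h).symm
    _ ≤ _ := Finset.sum_le_sum_of_subset (Finset.subset_univ _)

/-! ### Existence of contractions -/

theorem builtSucc_acyclic (hm : IsMatch ρ G φ) (hl : ∀ v, ρ.l ∉ ρ.G.succ v)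
    (x : G.V ⊕ NewNode ρ) :
    ¬ Relation.TransGen (fun a b => b ∈ builtSucc ρ G φ a) x x := by
  -- New nodes sit at the level of the contracted node and are ordered by their rank in the rule.
  -- Redirection does not raise the level of a target, so edges from old nodes still descend. An
  -- edge from a new to an old node descends because its target is strictly below `φ ρ.l`; by `hl`
  -- the target is not the left root itself.
  let rk : G.V ⊕ NewNode ρ → ℕ × ℕ :=
    Sum.elim (fun v => (G.rank v, 0)) (fun w => (G.rank (φ ρ.l), ρ.G.rank w.1))
  refine LGraph.acyclic_of_rank (r := Prod.Lex (· < ·) (· < ·))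
    (WellFounded.prod_lex Nat.lt_wfRel.wf Nat.lt_wfRel.wf) rk ?_ x
  have hplace : ∀ u, ρ.G.Reach ρ.r u → ρ.G.Reach ρ.l u → u ≠ ρ.l →
      (rk (place ρ G φ u)).1 < G.rank (φ ρ.l) := by
    intro u _ hlu hne
    rw [place_of_reach hlu]
    exact G.rank_lt (hm.transGen hlu hne)
  rintro (v | w) u hu
  · simp only [builtSucc, List.mem_map] at hu
    obtain ⟨u, hu, rfl⟩ := hu
    refine .left _ _ ?_
    have hlt := G.rank_lt_of_mem_succ hu
    by_cases h : u = φ ρ.l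
    · subst h
      rw [redirect_left]
      by_cases hr : ρ.G.Reach ρ.l ρ.r
      · exact (hplace _ .refl hr ρ.ne.symm).trans hlt
      · rwa [place_of_new ⟨.refl, hr⟩]
    · rwa [redirect_of_ne (by simpa using h)]
  · simp only [builtSucc, List.mem_map] at hu
    obtain ⟨u, hu, rfl⟩ := hu
    have hru : ρ.G.Reach ρ.r u := w.2.1.tail hu
    by_cases hlu : ρ.G.Reach ρ.l u
    · have hne : u ≠ ρ.l := fun h => hl _ (h ▸ hu)
      rw [redirect_of_ne]
      · exact .left _ _ (hplace u hru hlu hne)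
      · rw [place_of_reach hlu]
        intro he
        have := hm.transGen hlu hne
        rw [Sum.inl_injective he] at this
        exact G.acyclic _ this
    · rw [place_of_new ⟨hru, hlu⟩, redirect_of_ne (by simp)]
      exact .right _ (ρ.G.rank_lt_of_mem_succ hu)

theorem exists_contracts (hm : IsMatch ρ G φ) (hl : ∀ v, ρ.l ∉ ρ.G.succ v) :
    ∃ H, Contracts ρ G H φ := by
  have := G.finite
  have := ρ.G.finite
  let rt := redirect ρ G φ (.inl G.root)
  let E : G.V ⊕ NewNode ρ → G.V ⊕ NewNode ρ → Prop := fun a b => b ∈ builtSucc ρ G φ a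
  let V := {x // Relation.ReflTransGen E rt x}
  let sc : V → List V := fun v =>
    (builtSucc ρ G φ v.1).pmap Subtype.mk fun b hb => v.2.tail hb
  have hsc : ∀ v, (sc v).map Subtype.val = builtSucc ρ G φ v.1 := by
    intro v
    simp [sc, List.map_pmap]
  have hmem : ∀ {a b : V}, b ∈ sc a ↔ E a.1 b.1 := by
    intro a b
    simp only [E, ← hsc, List.mem_map]
    constructor
    · exact fun h => ⟨b, h, rfl⟩
    · rintro ⟨c, hc, h⟩
      rwa [← Subtype.ext h]
  let H : TermGraph σ :=
    { V := V
      lab := fun v => builtLab ρ G v.1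
      succ := sc
      length_succ := by
        intro v s hs
        rw [← List.length_map (f := Subtype.val) (as := sc v), hsc]
        rcases v with ⟨v | w, hv⟩
        · simpa [builtSucc] using G.length_succ v s hs
        · simpa [builtSucc] using ρ.G.length_succ w.1 s hs
      succ_var := by
        intro v hs
        rw [← List.map_eq_nil_iff (f := Subtype.val), hsc]
        rcases v with ⟨v | w, hv⟩
        · simpa [builtSucc] using G.succ_var v hs
        · simpa [builtSucc] using ρ.G.succ_var w.1 hs
      acyclic := by
        intro v h
        refine builtSucc_acyclic hm hl v.1 ?_
        exact Relation.TransGen.lift (p := E) Subtype.val (fun _ _ hab => hmem.1 hab) v v h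
      root := ⟨rt, .refl⟩
      reach_root := by
        rintro ⟨v, hv⟩
        induction hv with
        | refl => exact .refl
        | tail h1 h2 ih => exact .tail ih (hmem.2 h2) }
  exact ⟨H, Subtype.val, Subtype.val_injective, rfl, fun v => ⟨rfl, hsc v⟩⟩

end Contraction

end SafeGRS

/-! ### From local conditions on rules to the step bound and correctness -/

namespace SafeGRS

variable {N : ℕ} {ar : Fin N → ℕ} {σ : Signature ar}

/-- The properties of a rule, relative to an interpretation `R` and to node weights `w`, on which
correctness and the bound on the number of steps rest. -/
structure GoodRule (R : σ.Sym → List (Tm ar) → Tm ar → Prop) (w : ℕ → Option σ.Sym → ℕ)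
    (ρ : Rule σ) : Prop where
  lab_left : ∃ d, ρ.G.lab ρ.l = some (.inr d)
  con : ∀ v, ρ.G.Reach ρ.l v → v ≠ ρ.l → ∀ s, ρ.G.lab v = some s → σ.IsCon s
  left_notMem : ∀ v, ρ.l ∉ ρ.G.succ v
  normal : NormalRule ρ
  sound : Sound R ρ
  newWeight_lt : ∀ (G : TermGraph σ) (φ : ρ.G.V → G.V), IsMatch ρ G φ →
    ∀ X, NormalSet G.toLGraph X → ∀ n, X.ncard ≤ n → newWeight (w n) ρ < w n (ρ.G.lab ρ.l)

theorem Steps.reflTransGen {S : Set (Rule σ)} {m : ℕ} {G H : TermGraph σ} (h : Steps S m G H) :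
    Relation.ReflTransGen (Step S) G H := by
  induction h with
  | refl => exact .refl
  | tail _ h ih => exact ih.tail h

/-- Constructors have no normal positions, so in a basic graph the root alone has normal arguments.
-/
theorem TermGraph.Basic.normalSet {G : TermGraph σ} (hG : G.Basic) :
    NormalSet G.toLGraph {u : G.V | ∃ v ∈ G.nrmSucc G.root, G.Reach v u} where
  closed := by
    rintro v ⟨a, ha, hv⟩ u hu
    exact ⟨a, ha, hv.tail hu⟩
  con := by
    rintro v ⟨a, ha, hv⟩ s hs
    exact hG.2 a (G.mem_succ_of_mem_nrmSucc ha) v hv s hs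
  nrm := by
    intro v u hu
    by_cases hv : v = G.root
    · exact ⟨u, hv ▸ hu, .refl⟩
    · obtain ⟨a, ha, hav⟩ := (G.reach_root v).succ_of_ne hv
      rw [G.nrmSucc_of_isCon (hG.2 a ha v hav)] at hu
      simp at hu

section

variable {R : σ.Sym → List (Tm ar) → Tm ar → Prop} {w : ℕ → Option σ.Sym → ℕ}
  {S : Set (Rule σ)}

/-- The weights `w n` stay fixed during the derivation because `n` remains a bound on the normal
set. The weight added by a step is strictly less than that of the contracted node, so each step
costs at least one unit. -/
theorem Steps.add_weightSum_le (hS : ∀ ρ ∈ S, GoodRule R w ρ) {m n : ℕ} {G H : TermGraph σ}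
    (h : Steps S m G H) (hG : ∃ X, NormalSet G.toLGraph X ∧ X.ncard ≤ n) :
    (∃ X, NormalSet H.toLGraph X ∧ X.ncard ≤ n) ∧
      m + weightSum (w n) H.toLGraph ≤ weightSum (w n) G.toLGraph := by
  induction h with
  | refl => exact ⟨hG, by omega⟩
  | tail _ hstep ih =>
    obtain ⟨⟨X, hX, hXn⟩, hle⟩ := ih hG
    obtain ⟨ρ, hρ, φ, hm, hcon⟩ := hstep
    obtain ⟨ψ, hc⟩ := hcon.exists_isContractum
    have hg := hS ρ hρ
    obtain ⟨d, hd⟩ := hg.lab_left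
    refine ⟨⟨_, hX.contractum hm hd hg.normal hc, (hc.ncard_le X).trans hXn⟩, ?_⟩
    have h1 := hc.weightSum_le hm (w n)
    have h2 := hg.newWeight_lt _ φ hm X hX n hXn
    rw [(hm _ .refl _ hd).1] at h1
    rw [hd] at h2
    omega

theorem Steps.le_of_basic (hS : ∀ ρ ∈ S, GoodRule R w ρ)
    (hw : ∀ n c, w n (some (.inl c)) = 0) (hw' : ∀ n, w n none = 0)
    {m : ℕ} {G H : TermGraph σ} (h : Steps S m G H) (hG : G.Basic) :
    m ≤ w G.normalSize (G.lab G.root) := by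
  have hle := (h.add_weightSum_le (n := G.normalSize) hS ⟨_, hG.normalSet, le_rfl⟩).2
  have he : weightSum (w G.normalSize) G.toLGraph = w G.normalSize (G.lab G.root) := by
    have := G.finite
    let _ := Fintype.ofFinite G.V
    refine Finset.sum_eq_single _ (fun v _ hv => ?_) (fun h => absurd (Finset.mem_univ _) h)
    obtain ⟨a, ha, hav⟩ := (G.reach_root v).succ_of_ne hv
    cases hl : G.lab v with
    | none => exact hw' _
    | some s =>
      obtain ⟨c, rfl⟩ := hG.2 a ha v hav s hl
      exact hw _ c
  omega

/-- A closed graph with value `t`, all of whose normal arguments are maximally shared constructor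
graphs. -/
def SharedValue (R : σ.Sym → List (Tm ar) → Tm ar → Prop) (G : TermGraph σ) (t : Tm ar) : Prop :=
  ∃ α X, IsModel R G.toLGraph α ∧ α G.root = t ∧ NormalSet G.toLGraph X ∧
    SharedOn G.toLGraph α X

theorem SharedValue.step (hS : ∀ ρ ∈ S, GoodRule R w ρ) {G H : TermGraph σ} {t : Tm ar}
    (hG : SharedValue R G t) (h : Step S G H) : SharedValue R H t := by
  obtain ⟨α, X, hα, hr, hX, hs⟩ := hG
  obtain ⟨ρ, hρ, φ, hm, hcon⟩ := h
  obtain ⟨ψ, hc⟩ := hcon.exists_isContractum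
  have hg := hS ρ hρ
  obtain ⟨d, hd⟩ := hg.lab_left
  obtain ⟨α', h1, h2, h3⟩ := hg.sound.exists_isModel hm hc hα
  exact ⟨α', _, h1, h2.trans hr, hX.contractum hm hd hg.normal hc, hs.contractum hX hm hd hc h3⟩

theorem SharedValue.steps (hS : ∀ ρ ∈ S, GoodRule R w ρ) {G H : TermGraph σ} {t : Tm ar}
    (hG : SharedValue R G t) (h : Relation.ReflTransGen (Step S) G H) : SharedValue R H t := by
  induction h with
  | refl => exact hG
  | tail _ h ih => exact ih.step hS h

/-- The invariant without its sharing part, as required for graphs with arbitrary sharing. -/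
theorem exists_model_of_steps (hS : ∀ ρ ∈ S, GoodRule R w ρ) {G H : TermGraph σ} {t : Tm ar}
    (hG : ∃ α, IsModel R G.toLGraph α ∧ α G.root = t)
    (h : Relation.ReflTransGen (Step S) G H) : ∃ α, IsModel R H.toLGraph α ∧ α H.root = t := by
  induction h with
  | refl => exact hG
  | tail _ h ih =>
    obtain ⟨α, hα, hr⟩ := ih
    obtain ⟨ρ, hρ, φ, hm, hcon⟩ := h
    obtain ⟨ψ, hc⟩ := hcon.exists_isContractum
    obtain ⟨α', h1, h2, _⟩ := (hS ρ hρ).sound.exists_isModel hm hc hα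
    exact ⟨α', h1, h2.trans hr⟩

/-- The interpretation of the constructors as themselves. -/
def InterpretsCon (R : σ.Sym → List (Tm ar) → Tm ar → Prop) : Prop :=
  ∀ c L t, R (.inl c) L t ↔ ∃ ts, L = List.ofFn ts ∧ t = Tm.app c ts

theorem IsModel.value_eq_of_rep (hR : InterpretsCon R) {G : LGraph σ} {α : G.V → Tm ar}
    (hα : IsModel R G α) {v : G.V} {t : Tm ar} (h : G.Rep v t) : α v = t := by
  induction h with
  | mk v c us ts hl hs _ ih =>
    obtain ⟨s, hs', hv⟩ := hα v
    obtain rfl : s = .inl c := by simpa [hl, eq_comm] using hs'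
    obtain ⟨ts', h1, h2⟩ := (hR _ _ _).1 hv
    rw [hs, List.map_ofFn] at h1
    rw [h2, ← List.ofFn_injective h1]
    exact congrArg _ (funext ih)

theorem IsModel.succ_of_con (hR : InterpretsCon R) {G : LGraph σ} {α : G.V → Tm ar}
    (hα : IsModel R G α) {v : G.V} (h : ∀ s, G.lab v = some s → σ.IsCon s) :
    ∃ (c : Fin N) (us : Fin (ar c) → G.V), G.lab v = some (.inl c) ∧ G.succ v = List.ofFn us ∧
      α v = Tm.app c (fun i => α (us i)) := by
  obtain ⟨s, hs, hv⟩ := hα v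
  obtain ⟨c, rfl⟩ := h s hs
  obtain ⟨ts, h1, h2⟩ := (hR _ _ _).1 hv
  have hlen : (G.succ v).length = ar c := G.length_succ v _ hs
  refine ⟨c, fun i => (G.succ v).get (Fin.cast hlen.symm i), hs, ?_, ?_⟩
  · refine List.ext_getElem (by simp [hlen]) fun i h1 h2 => by simp
  · rw [h2]
    congr 1
    funext i
    have : (List.map α (G.succ v))[(i : ℕ)]? = (List.ofFn ts)[(i : ℕ)]? := by rw [h1]
    simpa [hlen] using this.symm

/-- `S` has a redex at every innermost defined symbol of a graph with shared normal arguments. -/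
def HasRedexes (R : σ.Sym → List (Tm ar) → Tm ar → Prop) (S : Set (Rule σ)) : Prop :=
  ∀ (G : TermGraph σ) (α : G.V → Tm ar) (X : Set G.V), IsModel R G.toLGraph α →
    NormalSet G.toLGraph X → SharedOn G.toLGraph α X → ∀ v d, G.lab v = some (.inr d) →
    (∀ u ∈ G.succ v, G.ConAt u) → ∃ ρ ∈ S, ∃ φ : ρ.G.V → G.V, IsMatch ρ G φ

/-- A defined symbol of least rank would be innermost and hence contractible. So only constructors
remain, and over constructors a node represents its value. -/
theorem SharedValue.rep_of_isNormal (hR : InterpretsCon R) (hS : ∀ ρ ∈ S, GoodRule R w ρ)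
    (hred : HasRedexes R S) {H : TermGraph σ} {t : Tm ar} (hH : SharedValue R H t)
    (hn : IsNormal S H) : H.Rep H.root t := by
  obtain ⟨α, X, hα, rfl, hX, hs⟩ := hH
  have hcon : ∀ n v, H.rank v = n → ∀ s, H.lab v = some s → σ.IsCon s := by
    intro n
    induction n using Nat.strong_induction_on with
    | _ n ih =>
      rintro v rfl (c | d) hl
      · exact ⟨c, rfl⟩
      · exfalso
        obtain ⟨ρ, hρ, φ, hm⟩ := hred H α X hα hX hs v d hl (by
          intro u hu x hx s hs
          exact ih _ (H.rank_lt (Relation.TransGen.head' hu hx)) x rfl s hs)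
        obtain ⟨K, hK⟩ := exists_contracts hm (hS ρ hρ).left_notMem
        exact hn K ⟨ρ, hρ, φ, hm, hK⟩
  have hrep : ∀ n v, H.rank v = n → H.Rep v (α v) := by
    intro n
    induction n using Nat.strong_induction_on with
    | _ n ih =>
      rintro v rfl
      obtain ⟨c, us, hl, hsu, hv⟩ := hα.succ_of_con hR (hcon _ v rfl)
      rw [hv]
      refine .mk v c us _ hl hsu fun i => ih _ (H.rank_lt_of_mem_succ ?_) _ rfl
      rw [hsu, List.mem_ofFn]
      exact ⟨i, rfl⟩
  exact hrep _ _ rfl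

theorem exists_isNormal_of_bounded {G : TermGraph σ} {B : ℕ}
    (hB : ∀ m H, Steps S m G H → m ≤ B) :
    ∃ H, Relation.ReflTransGen (Step S) G H ∧ IsNormal S H := by
  by_contra! hcon
  have h : ∀ m, ∃ H, Steps S m G H := by
    intro m
    induction m with
    | zero => exact ⟨G, .refl G⟩
    | succ m ih =>
      obtain ⟨H, hH⟩ := ih
      have := hcon H hH.reflTransGen
      unfold IsNormal at this
      push Not at this
      obtain ⟨K, hK⟩ := this
      exact ⟨K, hH.tail hK⟩
  obtain ⟨H, hH⟩ := h (B + 1)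
  have := hB _ _ hH
  omega

/-! ### Representations of calls -/

theorem TermGraph.RepCall.rep_succ {G : TermGraph σ} {k l : ℕ} {d : σ.D} {t : Fin k → Tm ar}
    {s : Fin l → Tm ar} (h : G.RepCall d t s) : ∀ v ∈ G.succ G.root, ∃ q, G.Rep v q := by
  obtain ⟨_, u, v, hs, hu, hv⟩ := h
  intro x hx
  rw [hs, List.mem_append, List.mem_ofFn, List.mem_ofFn] at hx
  rcases hx with ⟨i, rfl⟩ | ⟨i, rfl⟩
  · exact ⟨_, hu i⟩
  · exact ⟨_, hv i⟩

theorem TermGraph.RepCall.rep_of_ne {G : TermGraph σ} {k l : ℕ} {d : σ.D} {t : Fin k → Tm ar}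
    {s : Fin l → Tm ar} (h : G.RepCall d t s) {v : G.V} (hv : v ≠ G.root) : ∃ q, G.Rep v q := by
  obtain ⟨a, ha, hav⟩ := (G.reach_root v).succ_of_ne hv
  obtain ⟨q, hq⟩ := h.rep_succ a ha
  exact hq.of_reach hav

theorem TermGraph.RepCall.basic {G : TermGraph σ} {k l : ℕ} {d : σ.D} {t : Fin k → Tm ar}
    {s : Fin l → Tm ar} (h : G.RepCall d t s) : G.Basic :=
  ⟨⟨_, h.1, d, rfl⟩, fun v hv => (h.rep_succ v hv).choose_spec.conAt⟩

theorem TermGraph.RepCall.exists_model (hR : InterpretsCon R) {G : TermGraph σ} {k l : ℕ}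
    {d : σ.D} {t : Fin k → Tm ar} {s : Fin l → Tm ar} {q : Tm ar} (h : G.RepCall d t s)
    (hq : R (.inr d) (List.ofFn t ++ List.ofFn s) q) :
    ∃ α, IsModel R G.toLGraph α ∧ α G.root = q := by
  classical
  have hex : ∀ v, ∃ a, (v = G.root → a = q) ∧ (v ≠ G.root → G.Rep v a) := by
    intro v
    by_cases hv : v = G.root
    · exact ⟨q, fun _ => rfl, fun h => absurd hv h⟩
    · obtain ⟨a, ha⟩ := h.rep_of_ne hv
      exact ⟨a, fun h => absurd h hv, fun _ => ha⟩
  choose α hα hα' using hex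
  -- The root alone gets the value `q` instead of a represented term. By acyclicity it is nobody's
  -- argument, so this choice affects only the condition at the root.
  have hne : ∀ v, ∀ u ∈ G.succ v, u ≠ G.root := by
    rintro v _ hu rfl
    exact G.acyclic v (Relation.TransGen.head' hu (G.reach_root v))
  refine ⟨α, fun v => ?_, hα _ rfl⟩
  by_cases hv : v = G.root
  · obtain ⟨hl, u, w, hs, hu, hw⟩ := h
    subst hv
    refine ⟨_, hl, ?_⟩
    have e1 : α ∘ u = t := funext fun i => (hα' _ (hne G.root _ (by simp [hs]))).unique (hu i)
    have e2 : α ∘ w = s := funext fun i => (hα' _ (hne G.root _ (by simp [hs]))).unique (hw i)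
    rwa [hs, List.map_append, List.map_ofFn, List.map_ofFn, e1, e2, hα _ rfl]
  · have hr := hα' v hv
    generalize hb : α v = b at hr
    cases hr with
    | mk _ c us ts hl hs hr =>
      refine ⟨_, hl, (hR _ _ _).2 ⟨ts, ?_, rfl⟩⟩
      rw [hs, List.map_ofFn]
      congr 1
      funext i
      exact (hα' _ (hne v _ (by simp [hs]))).unique (hr i)

theorem TermGraph.RepCall.sharedValue (hR : InterpretsCon R) {G : TermGraph σ} {k l : ℕ}
    {d : σ.D} {t : Fin k → Tm ar} {s : Fin l → Tm ar} {q : Tm ar} (h : G.RepCall d t s)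
    (hq : R (.inr d) (List.ofFn t ++ List.ofFn s) q) (hG : G.NormalArgsShared) :
    SharedValue R G q := by
  obtain ⟨α, hα, hroot⟩ := h.exists_model hR hq
  refine ⟨α, _, hα, hroot, h.basic.normalSet, ?_⟩
  rintro x ⟨v, hv, hx⟩ a b ha hb hab
  obtain ⟨p, hp⟩ := h.rep_succ v (G.mem_succ_of_mem_nrmSucc hv)
  obtain ⟨p, hpa⟩ := hp.of_reach (hx.trans ha)
  obtain ⟨p', hpb⟩ := hp.of_reach (hx.trans hb)
  have e := hα.value_eq_of_rep hR hpa
  have e' := hα.value_eq_of_rep hR hpb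
  obtain rfl : p = p' := by rw [← e, hab, e']
  exact hG v hv a b (hx.trans ha) (hx.trans hb) p hpa hpb

/-- Calls are basic graphs, so the step bound yields termination, and preservation of values
identifies the result. -/
theorem defines_of_goodRules (hR : InterpretsCon R) (hS : ∀ ρ ∈ S, GoodRule R w ρ)
    (hw : ∀ n c, w n (some (.inl c)) = 0) (hw' : ∀ n, w n none = 0) (hred : HasRedexes R S)
    {d : σ.D} {k l : ℕ} (hk : σ.nrm d = k) (hl : σ.safe d = l)
    {f : (Fin k → Tm ar) → (Fin l → Tm ar) → Tm ar}
    (hf : ∀ x y, R (.inr d) (List.ofFn x ++ List.ofFn y) (f x y)) : Defines S d f := by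
  refine ⟨hk, hl, fun G t s hG => ⟨fun H hH q hq => ?_, fun hsh => ?_⟩⟩
  · obtain ⟨α, hα, hr⟩ := exists_model_of_steps hS (hG.exists_model hR (hf t s)) hH
    rw [← hr, hα.value_eq_of_rep hR hq]
  · have hv := hG.sharedValue hR (hf t s) hsh
    have hn : ∀ H, Relation.ReflTransGen (Step S) G H → IsNormal S H → H.Rep H.root (f t s) :=
      fun H hH hn => (hv.steps hS hH).rep_of_isNormal hR hS hred hn
    obtain ⟨H, hH, hnH⟩ := exists_isNormal_of_bounded fun m H h => h.le_of_basic hS hw hw' hG.basic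
    exact ⟨⟨H, hH, hn H hH hnH⟩, hn⟩

end

end SafeGRS

namespace SafeGRS

variable {N : ℕ} {ar : Fin N → ℕ} {σ : Signature ar}
  {R : σ.Sym → List (Tm ar) → Tm ar → Prop} {w : ℕ → Option σ.Sym → ℕ}

/-! ### Selection rules -/

/-- The nodes of a selection rule: the left root `u`, the normal arguments `x`, the safe arguments
`z`, and the arguments `a` of the constructor at the first safe argument. -/
inductive SelNode (k l n : ℕ) : Type
  | u : SelNode k l n
  | x (i : Fin k) : SelNode k l n
  | z (i : Fin l) : SelNode k l n
  | a (i : Fin n) : SelNode k l n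

instance (k l n : ℕ) : Finite (SelNode k l n) :=
  Finite.of_surjective
    (Sum.elim (fun _ : Unit => SelNode.u) (Sum.elim SelNode.x (Sum.elim SelNode.z SelNode.a)))
    (by
      rintro (_ | i | i | i)
      exacts [⟨.inl (), rfl⟩, ⟨.inr (.inl i), rfl⟩, ⟨.inr (.inr (.inl i)), rfl⟩,
        ⟨.inr (.inr (.inr i)), rfl⟩])

/-- The number of arguments of an optional constructor. -/
abbrev optAr (ar : Fin N → ℕ) (c : Option (Fin N)) : ℕ := c.elim 0 ar

/-- The graph `f (x; z)`, in which the first safe argument has the root constructor `c`, if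
any. -/
abbrev selGraph (f : σ.D) (k l : ℕ) (hf : σ.nrm f + σ.safe f = k + l) (c : Option (Fin N)) :
    LGraph σ where
  V := SelNode k l (optAr ar c)
  lab
    | .u => some (.inr f)
    | .z i => if (i : ℕ) = 0 then c.map .inl else none
    | _ => none
  succ
    | .u => List.ofFn .x ++ List.ofFn .z
    | .z i => if (i : ℕ) = 0 then List.ofFn .a else []
    | _ => []
  length_succ := by
    rintro (_ | i | i | i) s hs
    · simp only [Option.some.injEq] at hs
      subst hs
      simp [Signature.arity, hf]
    · simp at hs
    · cases c <;> by_cases hi : (i : ℕ) = 0 <;> simp [hi] at hs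
      subst hs
      simp [hi, Signature.arity, optAr]
    · simp at hs
  succ_var := by
    rintro (_ | i | i | i) hs
    · simp at hs
    · rfl
    · cases c <;> by_cases hi : (i : ℕ) = 0 <;> simp [hi] at hs <;> simp [hi, optAr]
    · rfl
  acyclic := LGraph.acyclic_of_rank (r := (· < ·)) Nat.lt_wfRel.wf
    (fun b => match b with | .u => 2 | .z _ => 1 | _ => 0) (by
      rintro (_ | i | i | i) v hv
      · simp only [List.mem_append, List.mem_ofFn] at hv
        rcases hv with ⟨j, rfl⟩ | ⟨j, rfl⟩ <;> simp
      · simp at hv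
      · by_cases hi : (i : ℕ) = 0 <;> simp only [hi, if_true, if_false] at hv
        · simp only [List.mem_ofFn] at hv
          obtain ⟨j, rfl⟩ := hv
          simp
        · simp at hv
      · simp at hv)

/-- The rule that rewrites `f (x; z)` to its node `r`. -/
abbrev selRule (f : σ.D) (k l : ℕ) (hf : σ.nrm f + σ.safe f = k + l) (c : Option (Fin N))
    (r : SelNode k l (optAr ar c)) (hr : SelNode.u ≠ r) : Rule σ where
  G := selGraph f k l hf c
  l := .u
  r := r
  ne := hr

section Sel

variable {f : σ.D} {k l : ℕ} {hf : σ.nrm f + σ.safe f = k + l} {c : Option (Fin N)}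

theorem selGraph_reach_x (i : Fin k) : (selGraph f k l hf c).Reach .u (.x i) :=
  .single (by simp [selGraph])

theorem selGraph_reach_z (i : Fin l) : (selGraph f k l hf c).Reach .u (.z i) :=
  .single (by simp [selGraph])

theorem selGraph_reach_a (hl : 0 < l) (i : Fin (optAr ar c)) :
    (selGraph f k l hf c).Reach .u (.a i) :=
  (selGraph_reach_z ⟨0, hl⟩).tail (by simp [selGraph])

theorem goodRule_selRule {r : SelNode k l (optAr ar c)} {hr : SelNode.u ≠ r}
    (hreach : (selGraph f k l hf c).Reach .u r)
    (hsound : ∀ α : SelNode k l (optAr ar c) → Tm ar,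
      R (.inr f) (List.ofFn (fun i => α (.x i)) ++ List.ofFn (fun i => α (.z i))) (α .u) →
      (∀ i : Fin l, (i : ℕ) = 0 → ∀ e, c = some e →
        R (.inl e) (List.ofFn fun i => α (.a i)) (α (.z i))) →
      α .u = α r)
    (hw : ∀ n, 0 < w n (some (.inr f))) :
    GoodRule R w (selRule f k l hf c r hr) where
  lab_left := ⟨f, rfl⟩
  con := by
    rintro (_ | i | i | i) _ hne s hs
    · exact absurd rfl hne
    · simp at hs
    · by_cases hi : (i : ℕ) = 0 <;> simp [hi] at hs
      obtain ⟨e, _, rfl⟩ := hs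
      exact ⟨e, rfl⟩
    · simp at hs
  left_notMem := by
    rintro (_ | i | i | i) <;> simp [selRule, selGraph, List.mem_ofFn]
  normal := fun v hv hnv => absurd (Relation.ReflTransGen.trans hreach hv) hnv
  sound := by
    intro α hα
    refine ⟨α, fun _ _ => rfl, fun v hv hnv => absurd (hreach.trans hv) hnv, ?_⟩
    refine hsound α ?_ ?_
    · have := hα .u .refl _ rfl
      simpa [selRule, selGraph, List.map_append, List.map_ofFn, Function.comp_def] using this
    · rintro i hi e rfl
      have := hα (.z i) (selGraph_reach_z (hf := hf) i) (.inl e) (by simp [hi])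
      change R (.inl e) (List.map α (if (i : ℕ) = 0 then List.ofFn .a else [])) _ at this
      rwa [if_pos hi, List.map_ofFn] at this
  newWeight_lt := by
    intro G φ _ X _ n _
    -- The right-hand side lies inside the left-hand side: there are no new nodes, and the empty
    -- type enumerates them.
    refine (newWeight_le (w n) _ (Empty.elim) ?_).trans_lt ?_
    · exact fun v hv hnv => absurd (Relation.ReflTransGen.trans hreach hv) hnv
    · simpa using hw n

theorem isSubgraphRule_selRule {r : SelNode k l (optAr ar c)} {hr : SelNode.u ≠ r}
    (hreach : (selGraph f k l hf c).Reach .u r) : IsSubgraphRule (selRule f k l hf c r hr) :=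
  ⟨hreach, hr.symm⟩

theorem exists_isMatch_selRule {r : SelNode k l (optAr ar c)} {hr : SelNode.u ≠ r}
    {G : TermGraph σ} {v : G.V} (hv : G.lab v = some (.inr f)) {x : Fin k → G.V} {z : Fin l → G.V}
    (hs : G.succ v = List.ofFn x ++ List.ofFn z) {a : Fin (optAr ar c) → G.V}
    (ha : ∀ i : Fin l, (i : ℕ) = 0 → ∀ e, c = some e →
      G.lab (z i) = some (.inl e) ∧ G.succ (z i) = List.ofFn a) :
    ∃ φ, IsMatch (selRule f k l hf c r hr) G φ := by
  refine ⟨fun | .u => v | .x i => x i | .z i => z i | .a i => a i, ?_⟩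
  rintro (_ | i | i | i) _ s hls
  · simp only [Option.some.injEq] at hls
    subst hls
    exact ⟨hv, by simp [selRule, selGraph, List.map_ofFn, Function.comp_def, hs]⟩
  · simp at hls
  · by_cases hi : (i : ℕ) = 0 <;> simp [hi] at hls
    obtain ⟨e, hce, rfl⟩ := hls
    obtain ⟨h1, h2⟩ := ha i hi e hce
    exact ⟨h1, by simp [selRule, selGraph, List.map_ofFn, Function.comp_def, hi, h2]⟩
  · simp at hls

end Sel

/-! ### Composition rules -/

instance (k l n : ℕ) : Finite (CNode k l n) :=
  Finite.of_surjective
    (Sum.elim (fun b : Bool => if b then CNode.u else CNode.v)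
      (Sum.elim CNode.x (Sum.elim CNode.z CNode.w)))
    (by
      rintro (_ | _ | i | i | i)
      exacts [⟨.inl true, rfl⟩, ⟨.inl false, rfl⟩, ⟨.inr (.inl i), rfl⟩,
        ⟨.inr (.inr (.inl i)), rfl⟩, ⟨.inr (.inr (.inr i)), rfl⟩])

/-- The rule `f (x; z) → h (x_{j_1}, …, x_{j_m}; g_1 (x; z), …, g_n (x; z))`. -/
abbrev compRule (f : σ.D) (k l : ℕ) (hf : σ.nrm f + σ.safe f = k + l) {m n : ℕ} (h : σ.Sym)
    (hh : σ.arity h = m + n) (g : Fin n → σ.D) (hg : ∀ i, σ.nrm (g i) + σ.safe (g i) = k + l)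
    (j : Fin m → Fin k) : Rule σ where
  G :=
    { V := CNode k l n
      lab := fun
        | .u => some (.inr f)
        | .v => some h
        | .w i => some (.inr (g i))
        | _ => none
      succ := fun
        | .u => List.ofFn .x ++ List.ofFn .z
        | .v => List.ofFn (fun i => .x (j i)) ++ List.ofFn .w
        | .w _ => List.ofFn .x ++ List.ofFn .z
        | _ => []
      length_succ := by
        rintro (_ | _ | i | i | i) s hs <;> simp only [Option.some.injEq, reduceCtorEq] at hs <;>
          subst hs
        · simp [Signature.arity, hf]
        · simp [hh]
        · simp [Signature.arity, hg]
      succ_var := by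
        rintro (_ | _ | i | i | i) hs <;> simp at hs ⊢
      acyclic := LGraph.acyclic_of_rank (r := (· < ·)) Nat.lt_wfRel.wf
        (fun b => match b with | .u => 2 | .v => 2 | .w _ => 1 | _ => 0) (by
          rintro (_ | _ | i | i | i) b hv
          · simp only [List.mem_append, List.mem_ofFn] at hv
            rcases hv with ⟨j, rfl⟩ | ⟨j, rfl⟩ <;> simp
          · simp only [List.mem_append, List.mem_ofFn] at hv
            rcases hv with ⟨j, rfl⟩ | ⟨j, rfl⟩ <;> simp
          · simp at hv
          · simp at hv
          · simp only [List.mem_append, List.mem_ofFn] at hv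
            rcases hv with ⟨j, rfl⟩ | ⟨j, rfl⟩ <;> simp) }
  l := .u
  r := .v
  ne := by simp

section Comp

variable {f : σ.D} {k l : ℕ} {hf : σ.nrm f + σ.safe f = k + l} {m n : ℕ} {h : σ.Sym}
    {hh : σ.arity h = m + n} {g : Fin n → σ.D} {hg : ∀ i, σ.nrm (g i) + σ.safe (g i) = k + l}
    {j : Fin m → Fin k}

theorem compRule_reach_left (b : CNode k l n) :
    (compRule f k l hf h hh g hg j).G.Reach .u b ↔
      b = .u ∨ (∃ i, b = .x i) ∨ ∃ i, b = .z i := by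
  constructor
  · intro hb
    refine LGraph.IsClosedSet.reach (G := (compRule f k l hf h hh g hg j).G)
      (X := {b : CNode k l n | b = .u ∨ (∃ i, b = .x i) ∨ ∃ i, b = .z i}) ?_ (.inl rfl) hb
    rintro _ (rfl | ⟨i, rfl⟩ | ⟨i, rfl⟩) b hb
    · simp only [compRule, List.mem_append, List.mem_ofFn] at hb
      rcases hb with ⟨i, rfl⟩ | ⟨i, rfl⟩
      · exact .inr (.inl ⟨i, rfl⟩)
      · exact .inr (.inr ⟨i, rfl⟩)
    · simp [compRule] at hb
    · simp [compRule] at hb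
  · rintro (rfl | ⟨i, rfl⟩ | ⟨i, rfl⟩)
    · exact .refl
    · exact .single (by simp [compRule])
    · exact .single (by simp [compRule])

theorem goodRule_compRule (hk : σ.nrm f = k) (hm : σ.nrmAr h = m) (hgk : ∀ i, σ.nrm (g i) = k)
    (hsound : ∀ x z t, R (.inr f) (List.ofFn (n := k) x ++ List.ofFn (n := l) z) t →
      ∃ y : Fin n → Tm ar, (∀ i, R (.inr (g i)) (List.ofFn x ++ List.ofFn z) (y i)) ∧
        R h (List.ofFn (fun i => x (j i)) ++ List.ofFn y) t)
    (hw : ∀ b, w b (some h) + ∑ i, w b (some (.inr (g i))) < w b (some (.inr f))) :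
    GoodRule R w (compRule f k l hf h hh g hg j) where
  lab_left := ⟨f, rfl⟩
  con := by
    intro b hb hne s hs
    rcases (compRule_reach_left b).1 hb with rfl | ⟨i, rfl⟩ | ⟨i, rfl⟩
    · exact absurd rfl hne
    · simp at hs
    · simp at hs
  left_notMem := by
    rintro (_ | _ | i | i | i) <;> simp [compRule, List.mem_ofFn]
  normal := by
    have hx : ∀ i, CNode.x i ∈ (compRule f k l hf h hh g hg j).G.nrmSucc .u := by
      intro i
      rw [LGraph.nrmSucc_of_lab (s := .inr f) _ rfl]
      simp [compRule, Signature.nrmAr, hk]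
    rintro (_ | _ | i | i | i) _ hnv b hb
    · exact absurd ((compRule_reach_left _).2 (by simp)) hnv
    · rw [LGraph.nrmSucc_of_lab (s := h) _ rfl] at hb
      simp only [compRule, hm] at hb
      rw [List.take_left' (by simp), List.mem_ofFn] at hb
      obtain ⟨i, rfl⟩ := hb
      exact ⟨_, hx _, .refl⟩
    · exact absurd ((compRule_reach_left _).2 (by simp)) hnv
    · exact absurd ((compRule_reach_left _).2 (by simp)) hnv
    · rw [LGraph.nrmSucc_of_lab (s := .inr (g i)) _ rfl] at hb
      simp only [compRule, Signature.nrmAr, hgk] at hb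
      rw [List.take_left' (by simp), List.mem_ofFn] at hb
      obtain ⟨i, rfl⟩ := hb
      exact ⟨_, hx _, .refl⟩
  sound := by
    intro α hα
    obtain ⟨y, hy, ht⟩ := hsound (fun i => α (.x i)) (fun i => α (.z i)) (α .u) (by
      have := hα .u .refl _ rfl
      simpa [compRule, List.map_ofFn, Function.comp_def] using this)
    refine ⟨fun | .u => α .u | .v => α .u | .x i => α (.x i) | .z i => α (.z i) | .w i => y i,
      ?_, ?_, rfl⟩
    · intro b hb
      rcases (compRule_reach_left b).1 hb with rfl | ⟨i, rfl⟩ | ⟨i, rfl⟩ <;> rfl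
    · rintro (_ | _ | i | i | i) _ hnv
      · exact absurd ((compRule_reach_left _).2 (by simp)) hnv
      · refine ⟨_, rfl, ?_⟩
        simpa [compRule, List.map_ofFn, Function.comp_def] using ht
      · exact absurd ((compRule_reach_left _).2 (by simp)) hnv
      · exact absurd ((compRule_reach_left _).2 (by simp)) hnv
      · refine ⟨_, rfl, ?_⟩
        simpa [compRule, List.map_ofFn, Function.comp_def] using hy i
  newWeight_lt := by
    intro G φ _ X _ b _
    refine (newWeight_le (w b) (compRule f k l hf h hh g hg j)
      (fun o : Option (Fin n) => o.elim CNode.v CNode.w) ?_).trans_lt ?_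
    · rintro (_ | _ | i | i | i) _ hnv
      · exact absurd ((compRule_reach_left _).2 (by simp)) hnv
      · exact ⟨none, rfl⟩
      · exact absurd ((compRule_reach_left _).2 (by simp)) hnv
      · exact absurd ((compRule_reach_left _).2 (by simp)) hnv
      · exact ⟨some i, rfl⟩
    · rw [Fintype.sum_option]
      exact hw b

theorem isCompositionRule_compRule (hk : σ.nrm f = k) (hm : σ.nrmAr h = m)
    (hgk : ∀ i, σ.nrm (g i) = k) : IsCompositionRule (compRule f k l hf h hh g hg j) :=
  ⟨k, l, m, n, Equiv.refl _, j, .inr f, h, fun i => .inr (g i), rfl, rfl, fun _ => rfl,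
    fun _ => rfl, rfl, hk, rfl, rfl, hm, rfl, fun i => ⟨rfl, hgk i, rfl⟩⟩

theorem exists_isMatch_compRule {G : TermGraph σ} {v : G.V} (hv : G.lab v = some (.inr f))
    {x : Fin k → G.V} {z : Fin l → G.V} (hs : G.succ v = List.ofFn x ++ List.ofFn z) :
    ∃ φ, IsMatch (compRule f k l hf h hh g hg j) G φ := by
  -- The values at `.v` and `.w` are arbitrary, since these nodes are not in the left-hand side.
  refine ⟨fun | .u => v | .v => v | .x i => x i | .z i => z i | .w _ => v, ?_⟩
  intro b hb s hls
  rcases (compRule_reach_left b).1 hb with rfl | ⟨i, rfl⟩ | ⟨i, rfl⟩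
  · simp only [Option.some.injEq] at hls
    subst hls
    exact ⟨hv, by simp [compRule, List.map_ofFn, Function.comp_def, hs]⟩
  · simp at hls
  · simp at hls

end Comp

end SafeGRS

namespace SafeGRS

variable {N : ℕ} {ar : Fin N → ℕ} {σ : Signature ar}
  {R : σ.Sym → List (Tm ar) → Tm ar → Prop} {w : ℕ → Option σ.Sym → ℕ}

/-! ### Unfolding rules -/

instance (m k l : ℕ) : Finite (UNode m k l) :=
  Finite.of_surjective
    (Sum.elim (fun _ : Unit => UNode.y)
      (Sum.elim UNode.v (Sum.elim UNode.w (Sum.elim UNode.x UNode.z))))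
    (by
      rintro (_ | i | i | i | i)
      exacts [⟨.inl (), rfl⟩, ⟨.inr (.inl i), rfl⟩, ⟨.inr (.inr (.inl i)), rfl⟩,
        ⟨.inr (.inr (.inr (.inl i))), rfl⟩, ⟨.inr (.inr (.inr (.inr i))), rfl⟩])

/-- An enumeration of the subterms of `t` that starts with `t`. -/
structure SubtermEnum (t : Tm ar) (m : ℕ) where
  enum : Fin (m + 1) ≃ t.subterms
  enum_zero : enum 0 = ⟨t, t.self_mem_subterms⟩

theorem SubtermEnum.exists (t : Tm ar) : ∃ m, Nonempty (SubtermEnum t m) := by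
  have := t.finite_subterms.to_subtype
  obtain ⟨n, ⟨e⟩⟩ := Finite.exists_equiv_fin t.subterms
  obtain ⟨m, rfl⟩ : ∃ m, n = m + 1 :=
    Nat.exists_eq_succ_of_ne_zero fun h =>
      (Fin.cast h (e ⟨t, t.self_mem_subterms⟩)).elim0
  -- The transposition moves `t` to index `0`, where the unfolding rule has its recursion argument.
  exact ⟨m, ⟨⟨(Equiv.swap 0 (e ⟨t, t.self_mem_subterms⟩)).trans e.symm, by simp⟩⟩⟩

namespace SubtermEnum

variable {t : Tm ar} {m : ℕ} (E : SubtermEnum t m)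

/-- The `i`-th subterm. -/
def term (i : Fin (m + 1)) : Tm ar := (E.enum i).1

/-- The indices of the arguments of the `i`-th subterm. -/
def child (i : Fin (m + 1)) (j : Fin (ar (E.term i).head)) : Fin (m + 1) :=
  E.enum.symm ⟨(E.term i).args j, Tm.args_mem_subterms (E.enum i).2 j⟩

theorem term_child (i : Fin (m + 1)) (j : Fin (ar (E.term i).head)) :
    E.term (E.child i j) = (E.term i).args j := by
  simp [term, child]

theorem term_zero : E.term 0 = t := by
  simp [term, E.enum_zero]

theorem term_injective : Function.Injective E.term :=
  Subtype.val_injective.comp E.enum.injective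

theorem size_child_lt (i : Fin (m + 1)) (j : Fin (ar (E.term i).head)) :
    (E.term (E.child i j)).size < (E.term i).size := by
  rw [term_child]
  exact Tm.size_args_lt _ _

/-- An induction principle that follows the arguments. -/
theorem induction_child {P : Fin (m + 1) → Prop} (h0 : P 0)
    (step : ∀ i, P i → ∀ j, P (E.child i j)) (i : Fin (m + 1)) : P i := by
  have key : ∀ s ∈ t.subterms, ∀ i, E.term i = s → P i := by
    refine Tm.subterms_induction (P := fun s => ∀ i, E.term i = s → P i) ?_ ?_
    · intro i hi
      rwa [E.term_injective (hi.trans E.term_zero.symm)]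
    · intro s hs ih j i hi
      obtain ⟨i', rfl⟩ : ∃ i', E.term i' = s := ⟨E.enum.symm ⟨s, hs⟩, by simp [term]⟩
      rw [E.term_injective (hi.trans (E.term_child i' j).symm)]
      exact step i' (ih i' rfl) j
  exact key _ (E.enum i).2 i rfl

end SubtermEnum

/-- The unfolding rule of `f` whose first argument is the maximally shared representation of the
term `t`. -/
abbrev unfRule (f : σ.D) (θ : Fin N → σ.D) (k l : ℕ) (hf : σ.nrm f + σ.safe f = 1 + (k + l))
    (hθ : ∀ c, σ.nrm (θ c) + σ.safe (θ c) = 2 * ar c + (k + l)) {t : Tm ar} {m : ℕ}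
    (E : SubtermEnum t m) : Rule σ where
  G :=
    { V := UNode m k l
      lab := fun
        | .y => some (.inr f)
        | .v i => some (.inl (E.term i).head)
        | .w i => some (.inr (θ (E.term i).head))
        | _ => none
      succ := fun
        | .y => .v 0 :: (List.ofFn .x ++ List.ofFn .z)
        | .v i => (List.ofFn (E.child i)).map .v
        | .w i => ((List.ofFn (E.child i)).map .v ++ List.ofFn .x) ++
            (List.ofFn .z ++ (List.ofFn (E.child i)).map .w)
        | _ => []
      length_succ := by
        rintro (_ | i | i | i | i) s hs <;>
          simp only [Option.some.injEq, reduceCtorEq] at hs <;> subst hs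
        · simp [Signature.arity, hf]; omega
        · simp [Signature.arity]
        · simp [Signature.arity, hθ]; omega
      succ_var := by
        rintro (_ | i | i | i | i) hs <;> simp at hs ⊢
      acyclic := LGraph.acyclic_of_rank (r := (· < ·)) Nat.lt_wfRel.wf
        (fun b => match b with
          | .y => t.size + 1 | .v i => (E.term i).size | .w i => (E.term i).size | _ => 0) (by
          rintro (_ | i | i | i | i) b hb
          · simp only [List.mem_cons, List.mem_append, List.mem_ofFn] at hb
            rcases hb with rfl | ⟨j, rfl⟩ | ⟨j, rfl⟩ <;> simp [E.term_zero]
          · simp only [List.mem_map, List.mem_ofFn] at hb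
            obtain ⟨_, ⟨j, rfl⟩, rfl⟩ := hb
            exact E.size_child_lt i j
          · simp only [List.mem_append, List.mem_map, List.mem_ofFn] at hb
            rcases hb with (⟨_, ⟨j, rfl⟩, rfl⟩ | ⟨j, rfl⟩) | (⟨j, rfl⟩ | ⟨_, ⟨j, rfl⟩, rfl⟩)
            · exact E.size_child_lt i j
            · exact Tm.size_pos _
            · exact Tm.size_pos _
            · exact E.size_child_lt i j
          · simp at hb
          · simp at hb) }
  l := .y
  r := .w 0
  ne := by simp

section Unf

variable {f : σ.D} {θ : Fin N → σ.D} {k l : ℕ} {hf : σ.nrm f + σ.safe f = 1 + (k + l)}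
    {hθ : ∀ c, σ.nrm (θ c) + σ.safe (θ c) = 2 * ar c + (k + l)} {t : Tm ar} {m : ℕ}
    {E : SubtermEnum t m}

theorem unfRule_reach_v (i : Fin (m + 1)) :
    (unfRule f θ k l hf hθ E).G.Reach (.v 0) (.v i) := by
  refine E.induction_child (P := fun i => (unfRule f θ k l hf hθ E).G.Reach (.v 0) (.v i))
    .refl (fun i ih j => ih.tail ?_) i
  simp

theorem unfRule_reach_v_iff (b : UNode m k l) :
    (unfRule f θ k l hf hθ E).G.Reach (.v 0) b ↔ ∃ i, b = .v i := by
  constructor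
  · intro hb
    refine LGraph.IsClosedSet.reach (G := (unfRule f θ k l hf hθ E).G)
      (X := {b : UNode m k l | ∃ i, b = .v i}) ?_ ⟨0, rfl⟩ hb
    rintro _ ⟨i, rfl⟩ b hb
    simp only [List.mem_map] at hb
    obtain ⟨i, _, rfl⟩ := hb
    exact ⟨i, rfl⟩
  · rintro ⟨i, rfl⟩
    exact unfRule_reach_v i

theorem unfRule_reach_left (b : UNode m k l) :
    (unfRule f θ k l hf hθ E).G.Reach .y b ↔
      b = .y ∨ (∃ i, b = .v i) ∨ (∃ i, b = .x i) ∨ ∃ i, b = .z i := by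
  constructor
  · intro hb
    refine LGraph.IsClosedSet.reach (G := (unfRule f θ k l hf hθ E).G)
      (X := {b : UNode m k l | b = .y ∨ (∃ i, b = .v i) ∨ (∃ i, b = .x i) ∨ ∃ i, b = .z i})
      ?_ (.inl rfl) hb
    rintro _ (rfl | ⟨i, rfl⟩ | ⟨i, rfl⟩ | ⟨i, rfl⟩) b hb
    · simp only [List.mem_cons, List.mem_append, List.mem_ofFn] at hb
      rcases hb with rfl | ⟨i, rfl⟩ | ⟨i, rfl⟩
      · exact .inr (.inl ⟨_, rfl⟩)
      · exact .inr (.inr (.inl ⟨i, rfl⟩))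
      · exact .inr (.inr (.inr ⟨i, rfl⟩))
    · simp only [List.mem_map] at hb
      obtain ⟨i, _, rfl⟩ := hb
      exact .inr (.inl ⟨i, rfl⟩)
    · simp at hb
    · simp at hb
  · rintro (rfl | ⟨i, rfl⟩ | ⟨i, rfl⟩ | ⟨i, rfl⟩)
    · exact .refl
    · exact .head (by simp) (unfRule_reach_v i)
    · exact .single (by simp)
    · exact .single (by simp)

theorem unfRule_not_reach_left {b : UNode m k l}
    (hb : ¬ (unfRule f θ k l hf hθ E).G.Reach .y b) : ∃ i, b = .w i := by
  rw [unfRule_reach_left] at hb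
  cases b <;> simp at hb ⊢

/-- Distinct nodes `.v i` stand for distinct terms. If two have the same image, their labels agree
and their arguments have the same images in turn, so induction on the term makes the two terms
equal. This is where maximal sharing in the rule limits the number of new nodes. -/
theorem unfRule_match_injective {G : TermGraph σ} {φ : UNode m k l → G.V}
    (hm : IsMatch (unfRule f θ k l hf hθ E) G φ) :
    Function.Injective fun i => φ (.v i) := by
  have hmv : ∀ i, G.lab (φ (.v i)) = some (.inl (E.term i).head) ∧
      G.succ (φ (.v i)) = List.ofFn fun a => φ (.v (E.child i a)) := by
    intro i
    obtain ⟨h1, h2⟩ := hm (.v i) ((unfRule_reach_left _).2 (.inr (.inl ⟨i, rfl⟩))) _ rfl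
    exact ⟨h1, by simpa [List.map_ofFn, Function.comp_def] using h2⟩
  have key : ∀ s s' : Tm ar, ∀ i j, E.term i = s → E.term j = s' → φ (.v i) = φ (.v j) →
      s = s' := by
    intro s
    induction s with
    | app c ts ih =>
      rintro ⟨c', ts'⟩ i j hi hj hij
      obtain ⟨h1, h2⟩ := hmv i
      obtain ⟨h1', h2'⟩ := hmv j
      rw [hij] at h1 h2
      have hc : (E.term i).head = (E.term j).head := by simpa [h1'] using h1.symm
      have hcc : c = c' := by simpa [hi, hj, Tm.head] using hc
      subst hcc
      congr 1
      funext a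
      -- Arguments are compared through their numerical position, as the index types for `i` and `j`
      -- agree only up to a propositional equality.
      have ha : ∀ i' (ts'' : Fin (ar c) → Tm ar), E.term i' = .app c ts'' →
          ∃ b : Fin (ar (E.term i').head), (b : ℕ) = a ∧ E.term (E.child i' b) = ts'' a := by
        intro i' ts'' hi'
        have hh : (E.term i').head = c := by rw [hi']; rfl
        refine ⟨Fin.cast (by rw [hh]) a, rfl, ?_⟩
        rw [E.term_child]
        clear h1 h2 h1' h2' hc
        generalize E.term i' = q at *
        subst hi'
        rfl
      obtain ⟨b, hb, hbt⟩ := ha i ts hi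
      obtain ⟨b', hb', hbt'⟩ := ha j ts' hj
      refine ih a _ _ _ hbt hbt' ?_
      have := congrArg (fun L => L[(a : ℕ)]?) (h2.symm.trans h2')
      have hlt : (a : ℕ) < ar (E.term i).head := hb ▸ b.2
      have hlt' : (a : ℕ) < ar (E.term j).head := hb' ▸ b'.2
      obtain rfl : b = ⟨a, hlt⟩ := Fin.ext hb
      obtain rfl : b' = ⟨a, hlt'⟩ := Fin.ext hb'
      simpa [hlt, hlt'] using this
  exact fun i j hij => E.term_injective (key _ _ i j rfl rfl hij)

theorem unfRule_value (hR : InterpretsCon R) {α : UNode m k l → Tm ar}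
    (hα : ∀ i, R (.inl (E.term i).head) (List.ofFn fun a => α (.v (E.child i a))) (α (.v i)))
    (i : Fin (m + 1)) : α (.v i) = E.term i := by
  have key : ∀ n i, (E.term i).size = n → α (.v i) = E.term i := by
    intro n
    induction n using Nat.strong_induction_on with
    | _ n ih =>
      rintro i rfl
      obtain ⟨ts, h1, h2⟩ := (hR _ _ _).1 (hα i)
      rw [h2, ← List.ofFn_injective h1]
      refine Eq.trans ?_ (Tm.app_head_args (E.term i))
      congr 1
      funext a
      rw [ih _ (E.size_child_lt i a) _ rfl, E.term_child]
  exact key _ i rfl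

/-- In `hsound`, `F` is the recursive function with its parameters fixed. The constructor part of
the rule forces `.v i` to have the `i`-th subterm as value, and `.w i` receives the value of `F`
there. -/
theorem goodRule_unfRule (hR : InterpretsCon R) (hk : σ.nrm f = 1 + k)
    (hθk : ∀ c, σ.nrm (θ c) = ar c + k)
    (hsound : ∀ (t : Tm ar) (x : Fin k → Tm ar) (z : Fin l → Tm ar) q,
      R (.inr f) (t :: (List.ofFn x ++ List.ofFn z)) q → ∃ F : Tm ar → Tm ar, F t = q ∧
        ∀ t : Tm ar, R (.inr (θ t.head)) ((List.ofFn t.args ++ List.ofFn x) ++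
          (List.ofFn z ++ List.ofFn fun i => F (t.args i))) (F t))
    (hw : ∀ b, b * ∑ c, w b (some (.inr (θ c))) < w b (some (.inr f))) :
    GoodRule R w (unfRule f θ k l hf hθ E) where
  lab_left := ⟨f, rfl⟩
  con := by
    intro b hb hne s hs
    rcases (unfRule_reach_left b).1 hb with rfl | ⟨i, rfl⟩ | ⟨i, rfl⟩ | ⟨i, rfl⟩
    · exact absurd rfl hne
    · simp only [Option.some.injEq] at hs
      exact ⟨_, hs.symm⟩
    · simp at hs
    · simp at hs
  left_notMem := by
    rintro (_ | i | i | i | i) <;> simp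
  normal := by
    have hnl : (unfRule f θ k l hf hθ E).G.nrmSucc .y = .v 0 :: List.ofFn .x := by
      rw [LGraph.nrmSucc_of_lab (s := .inr f) _ rfl]
      simp [Signature.nrmAr, hk, Nat.add_comm 1 k]
    intro b _ hnb u hu
    obtain ⟨i, rfl⟩ := unfRule_not_reach_left hnb
    rw [LGraph.nrmSucc_of_lab (s := .inr (θ (E.term i).head)) _ rfl] at hu
    simp only [Signature.nrmAr, hθk] at hu
    rw [List.take_left' (by simp), List.mem_append, List.mem_map, List.mem_ofFn] at hu
    rw [hnl]
    rcases hu with ⟨i, _, rfl⟩ | ⟨i, rfl⟩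
    · exact ⟨_, List.mem_cons_self, unfRule_reach_v i⟩
    · exact ⟨.x i, by simp, .refl⟩
  sound := by
    intro α hα
    have hv : ∀ i, α (.v i) = E.term i := by
      refine unfRule_value hR fun i => ?_
      have := hα (.v i) ((unfRule_reach_left _).2 (.inr (.inl ⟨i, rfl⟩))) _ rfl
      simpa [List.map_ofFn, Function.comp_def] using this
    obtain ⟨F, hFt, hF⟩ := hsound t (fun i => α (.x i)) (fun i => α (.z i)) (α .y) (by
      have := hα .y .refl _ rfl
      simpa [List.map_ofFn, Function.comp_def, hv, E.term_zero] using this)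
    refine ⟨fun | .y => α .y | .v i => α (.v i) | .x i => α (.x i) | .z i => α (.z i)
                | .w i => F (E.term i), ?_, ?_, ?_⟩
    · intro b hb
      rcases (unfRule_reach_left b).1 hb with rfl | ⟨i, rfl⟩ | ⟨i, rfl⟩ | ⟨i, rfl⟩ <;> rfl
    · intro b _ hnb
      obtain ⟨i, rfl⟩ := unfRule_not_reach_left hnb
      refine ⟨_, rfl, ?_⟩
      have := hF (E.term i)
      simpa [List.map_ofFn, Function.comp_def, hv, E.term_child] using this
    · simp only [E.term_zero, hFt]
  newWeight_lt := by
    intro G φ hm X hX b hXb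
    -- The nodes `.v i` are matched injectively into the normal set, whose size is at most `b`.
    have hcard : m + 1 ≤ b := by
      refine le_trans ?_ hXb
      have := G.finite
      have hinj := unfRule_match_injective hm
      rw [← Nat.card_fin (m + 1), ← Set.ncard_univ, ← Set.ncard_image_of_injective _ hinj]
      refine Set.ncard_le_ncard ?_ (Set.toFinite _)
      rintro _ ⟨i, _, rfl⟩
      refine hm.mem_closed_of_nrmSucc hX (a := .v 0) ?_ (unfRule_reach_v i)
      rw [LGraph.nrmSucc_of_lab (s := .inr f) _ rfl]
      simp [Signature.nrmAr, hk, Nat.add_comm 1 k]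
    refine (newWeight_le (w b) (unfRule f θ k l hf hθ E) UNode.w ?_).trans_lt
      (lt_of_le_of_lt ?_ (hw b))
    · intro v _ hnv
      obtain ⟨i, rfl⟩ := unfRule_not_reach_left hnv
      exact ⟨i, rfl⟩
    · calc ∑ i, w b (some (.inr (θ (E.term i).head)))
          ≤ ∑ _i : Fin (m + 1), ∑ c, w b (some (.inr (θ c))) :=
            Finset.sum_le_sum fun i _ =>
              Finset.single_le_sum (f := fun c => w b (some (.inr (θ c))))
                (fun _ _ => Nat.zero_le _) (Finset.mem_univ _)
        _ = (m + 1) * ∑ c, w b (some (.inr (θ c))) := by simp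
        _ ≤ _ := Nat.mul_le_mul_right _ hcard

theorem isSafeUnfolding_unfRule (hk : σ.nrm f = 1 + k) (hθk : ∀ c, σ.nrm (θ c) = ar c + k)
    (hinj : Function.Injective θ) (hne : ∀ c, θ c ≠ f) :
    IsSafeUnfolding (unfRule f θ k l hf hθ E) := by
  refine ⟨Set.range .inl, Set.range fun c => .inr (θ c),
    Sum.elim (fun c => .inr (θ c)) .inr, .inr f, m, k, l, Equiv.refl _,
    fun i => List.ofFn (E.child i), ?_, ⟨?_, ?_, ?_⟩, ?_, hf, ?_, rfl, rfl, rfl, hk, rfl,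
    fun _ => rfl, fun _ => rfl, fun _ => rfl, unfRule_reach_v_iff, ?_⟩
  · rw [Set.disjoint_left]
    rintro _ ⟨c, rfl⟩ ⟨c', h⟩
    simp at h
  · rintro _ ⟨c, rfl⟩
    exact ⟨c, rfl⟩
  · rintro _ ⟨c, rfl⟩ _ ⟨c', rfl⟩ h
    rw [hinj (Sum.inr_injective h)]
  · rintro _ ⟨c, rfl⟩
    exact ⟨_, ⟨c, rfl⟩, rfl⟩
  · rintro (⟨c, h⟩ | ⟨c, h⟩)
    · simp at h
    · exact hne c (Sum.inr_injective h)
  · rintro _ ⟨c, rfl⟩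
    exact hθ c
  · intro i
    exact ⟨.inl (E.term i).head, ⟨_, rfl⟩, rfl, rfl, by simp [Signature.nrmAr, hθk], rfl⟩

/-- Every subterm of `t` is the value of some node below `b`, and sharing makes this node unique.
Uniqueness turns the choice of nodes into a homomorphism. -/
theorem exists_isMatch_unfRule (hR : InterpretsCon R) {G : TermGraph σ} {α : G.V → Tm ar}
    (hα : IsModel R G.toLGraph α) {v b : G.V} (hv : G.lab v = some (.inr f)) {x : Fin k → G.V}
    {z : Fin l → G.V} (hs : G.succ v = b :: (List.ofFn x ++ List.ofFn z)) (hb : α b = t)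
    (hcon : G.ConAt b) (hsh : ∀ a a', G.Reach b a → G.Reach b a' → α a = α a' → a = a') :
    ∃ φ, IsMatch (unfRule f θ k l hf hθ E) G φ := by
  have hex : ∀ i, ∃ a, G.Reach b a ∧ α a = E.term i := by
    refine E.induction_child ⟨b, .refl, hb.trans E.term_zero.symm⟩ ?_
    rintro i ⟨a, ha, hai⟩ j
    obtain ⟨c, us, hl, hsu, hva⟩ := hα.succ_of_con hR (hcon a ha)
    rw [E.term_child]
    generalize E.term i = q at *
    obtain rfl := hva.symm.trans hai
    refine ⟨us j, ha.tail ?_, rfl⟩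
    rw [hsu, List.mem_ofFn]
    exact ⟨j, rfl⟩
  choose ξ hξ hξ' using hex
  refine ⟨fun | .y => v | .v i => ξ i | .x i => x i | .z i => z i | .w _ => v, ?_⟩
  intro u hu s hls
  rcases (unfRule_reach_left u).1 hu with rfl | ⟨i, rfl⟩ | ⟨i, rfl⟩ | ⟨i, rfl⟩
  · simp only [Option.some.injEq] at hls
    subst hls
    have : ξ 0 = b := hsh _ _ (hξ 0) .refl (by rw [hξ', hb, E.term_zero])
    exact ⟨hv, by simp [List.map_ofFn, Function.comp_def, hs, this]⟩
  · simp only [Option.some.injEq] at hls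
    subst hls
    obtain ⟨c, us, hl, hsu, hva⟩ := hα.succ_of_con hR (hcon _ (hξ i))
    have hh : (E.term i).head = c := by rw [← hξ', hva]; rfl
    refine ⟨by rw [hl, hh], ?_⟩
    -- Both nodes lie below `b` and have the `a`-th argument of the `i`-th subterm as value.
    have hus : ∀ a, us (Fin.cast (by rw [hh]) a) = ξ (E.child i a) := by
      intro a
      refine hsh _ _ ((hξ i).tail ?_) (hξ _) ?_
      · rw [hsu, List.mem_ofFn]
        exact ⟨_, rfl⟩
      · rw [hξ', E.term_child]
        have h := hva.symm.trans (hξ' i)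
        generalize E.term i = q at *
        subst h
        rfl
    rw [hsu]
    refine List.ext_getElem (by simp [hh]) fun n h1 h2 => ?_
    simp only [List.length_map, List.length_ofFn] at h2
    simpa using hus ⟨n, h2⟩
  · simp at hls
  · simp at hls

end Unf

end SafeGRS

namespace SafeGRS

open Polynomial

variable {N : ℕ} {ar : Fin N → ℕ}

/-! ### The graph rewrite system of a code -/

/-- The signature whose defined symbols are the constituents of a code, each in `N` copies, so that
the step functions of a recursion are represented by pairwise distinct symbols. -/
abbrev codeSig (e : AnyCode ar) : Signature ar where
  D := Fin N × e.parts
  finite :=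
    have := e.finite_parts.to_subtype
    inferInstance
  nrm d := d.2.1.1
  safe d := d.2.1.2.1

/-- The `a`-th copy of the symbol for `b`. -/
abbrev sym {e : AnyCode ar} (a : Fin N) (b : AnyCode ar) (hb : b ∈ e.parts) : (codeSig e).D :=
  (a, ⟨b, hb⟩)

/-- The interpretation of the symbols by the functions that the codes denote. -/
def interp (e : AnyCode ar) : (codeSig e).Sym → List (Tm ar) → Tm ar → Prop
  | .inl c, L, t => ∃ ts, L = List.ofFn ts ∧ t = Tm.app c ts
  | .inr d, L, t => ∃ x y, L = List.ofFn x ++ List.ofFn y ∧ t = d.2.1.2.2.sem x y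

/-- The weights of the symbols. -/
noncomputable def codeWeight (e : AnyCode ar) (n : ℕ) : Option (codeSig e).Sym → ℕ
  | some (.inr d) => d.2.1.2.2.weight.eval n
  | _ => 0

/-- The rules for a copy of a constituent of a code. -/
def codeRules {e : AnyCode ar} (a : Fin N) :
    (b : AnyCode ar) → b ∈ e.parts → Set (Rule (codeSig e))
  | ⟨k, l, .projNormal i⟩, hb => {selRule (sym a _ hb) k l rfl none (.x i) (by simp)}
  | ⟨k, l, .projSafe i⟩, hb => {selRule (sym a _ hb) k l rfl none (.z i) (by simp)}
  | ⟨_, _, .pred i j⟩, hb => Set.range fun c => selRule (sym a _ hb) 0 1 rfl (some c)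
      (if h : c = i then .a (Fin.cast (congrArg ar h.symm) j) else .z 0) (by split <;> simp)
  | ⟨_, _, .cond⟩, hb => Set.range fun c =>
      selRule (sym a _ hb) 0 (N + 1) rfl (some c) (.z c.succ) (by simp)
  | ⟨k, l, .con c g⟩, hb =>
      {compRule (m := 0) (n := ar c) (sym a _ hb) k l rfl (.inl c) (by simp [Signature.arity])
        (fun i => sym a ⟨_, _, g i⟩ (AnyCode.children_subset_parts hb ⟨i, rfl⟩)) (fun _ => rfl)
        Fin.elim0}
  | ⟨k, l, .comp h g j⟩, hb =>
      {compRule (sym a _ hb) k l rfl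
        (.inr (sym a ⟨_, _, h⟩ (AnyCode.children_subset_parts hb (.inl rfl)))) rfl
        (fun i => sym a ⟨_, _, g i⟩ (AnyCode.children_subset_parts hb (.inr ⟨i, rfl⟩)))
        (fun _ => rfl) j}
  | ⟨_, _, .recur (k := k) (l := l) h⟩, hb =>
      {ρ | ∃ t m, ∃ E : SubtermEnum t m, ρ = unfRule (sym a _ hb)
        (fun c => sym c ⟨_, _, h c⟩ (AnyCode.children_subset_parts hb ⟨c, rfl⟩)) k l
        (by simp only; omega) (fun c => by simp only; omega) E}

/-- The graph rewrite system of a code. -/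
def codeGRS (e : AnyCode ar) : Set (Rule (codeSig e)) :=
  ⋃ d : (codeSig e).D, codeRules d.1 d.2.1 d.2.2

theorem append_ofFn_inj {α : Type*} {k l : ℕ} {x x' : Fin k → α} {z z' : Fin l → α}
    (h : List.ofFn x ++ List.ofFn z = List.ofFn x' ++ List.ofFn z') : x = x' ∧ z = z' :=
  let ⟨h1, h2⟩ := List.append_inj h (by simp)
  ⟨List.ofFn_injective h1, List.ofFn_injective h2⟩

theorem exists_eq_append_ofFn {α : Type*} {k l : ℕ} {L : List α} (h : L.length = k + l) :
    ∃ (x : Fin k → α) (z : Fin l → α), L = List.ofFn x ++ List.ofFn z := by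
  refine ⟨fun i => L.get (Fin.cast h.symm (Fin.castAdd l i)),
    fun i => L.get (Fin.cast h.symm (Fin.natAdd k i)), ?_⟩
  rw [← List.ofFn_fin_append]
  refine List.ext_getElem (by simp [h]) fun i h1 h2 => ?_
  rw [List.getElem_ofFn]
  by_cases hi : i < k
  · rw [show (⟨i, by simpa using h2⟩ : Fin (k + l)) = Fin.castAdd l ⟨i, hi⟩ from rfl,
      Fin.append_left]
    rfl
  · obtain ⟨j, rfl⟩ := Nat.exists_eq_add_of_le (not_lt.1 hi)
    have hj : j < l := by omega
    rw [show (⟨k + j, by simpa using h2⟩ : Fin (k + l)) = Fin.natAdd k ⟨j, hj⟩ from rfl,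
      Fin.append_right]
    rfl

theorem ofFn_cons_append {α : Type*} {k l : ℕ} (a : α) (x : Fin k → α) (z : Fin l → α) :
    a :: (List.ofFn x ++ List.ofFn z) =
      List.ofFn (Fin.cons a x : Fin (k + 1) → α) ++ List.ofFn z := by
  simp [List.ofFn_succ]

/-! ### Verification of the rewrite system of a code -/

section

variable {e : AnyCode ar}

theorem interp_sym {a : Fin N} {k l : ℕ} {b : Code ar k l} {hb : ⟨k, l, b⟩ ∈ e.parts}
    {x : Fin k → Tm ar} {z : Fin l → Tm ar} {t : Tm ar} :
    interp e (.inr (sym a ⟨k, l, b⟩ hb)) (List.ofFn x ++ List.ofFn z) t ↔ t = b.sem x z := by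
  constructor
  · rintro ⟨x', z', h, rfl⟩
    obtain ⟨rfl, rfl⟩ := append_ofFn_inj h
    rfl
  · rintro rfl
    exact ⟨x, z, rfl, rfl⟩

theorem interpretsCon_interp : InterpretsCon (interp e) := fun _ _ _ => Iff.rfl

theorem interp_con_ofFn {c : Fin N} {ts : Fin (ar c) → Tm ar} {t : Tm ar} :
    interp e (.inl c) (List.ofFn ts) t ↔ t = Tm.app c ts := by
  constructor
  · rintro ⟨ts', h, rfl⟩
    rw [List.ofFn_injective h]
  · rintro rfl
    exact ⟨ts, rfl, rfl⟩

/-- Each case combines a defining equation of `sem` for soundness with one of `weight` for the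
decrease; the summand `1` in every weight makes the decrease strict. -/
theorem goodRule_codeRules (a : Fin N) (b : AnyCode ar) (hb : b ∈ e.parts) :
    ∀ ρ ∈ codeRules a b hb, GoodRule (interp e) (codeWeight e) ρ := by
  obtain ⟨k, l, b⟩ := b
  cases b with
  | projNormal i =>
    rintro _ rfl
    refine goodRule_selRule (selGraph_reach_x i) (fun α h _ => interp_sym.1 h) fun n => ?_
    simp [codeWeight, Code.weight]
  | projSafe i =>
    rintro _ rfl
    refine goodRule_selRule (selGraph_reach_z i) (fun α h _ => interp_sym.1 h) fun n => ?_
    simp [codeWeight, Code.weight]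
  | pred i j =>
    rintro _ ⟨c, rfl⟩
    refine goodRule_selRule ?_ (fun α h h' => ?_) fun n => ?_
    · split
      · exact selGraph_reach_a Nat.one_pos _
      · exact selGraph_reach_z _
    · have h0 := interp_con_ofFn.1 (h' 0 rfl c rfl)
      refine (interp_sym.1 h).trans ?_
      simp only [Code.sem, h0, predFn]
      split
      · rfl
      · exact h0.symm
    · simp [codeWeight, Code.weight]
  | cond =>
    rintro _ ⟨c, rfl⟩
    refine goodRule_selRule (selGraph_reach_z _) (fun α h h' => ?_) fun n => ?_
    · have h0 := interp_con_ofFn.1 (h' 0 rfl c rfl)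
      refine (interp_sym.1 h).trans ?_
      simp only [Code.sem, h0, condFn]
    · simp [codeWeight, Code.weight]
  | con c g =>
    rintro _ rfl
    refine goodRule_compRule rfl rfl (fun _ => rfl) (fun x z t h => ?_) fun n => ?_
    · refine ⟨fun i => (g i).sem x z, fun i => interp_sym.2 rfl, ?_⟩
      rw [interp_sym.1 h]
      exact interp_con_ofFn.2 rfl
    · simp [codeWeight, Code.weight, eval_finsetSum]
  | comp h g j =>
    rintro _ rfl
    refine goodRule_compRule rfl rfl (fun _ => rfl) (fun x z t h => ?_) fun n => ?_
    · refine ⟨fun i => (g i).sem x z, fun i => interp_sym.2 rfl, ?_⟩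
      rw [interp_sym.1 h]
      exact interp_sym.2 rfl
    · simp [codeWeight, Code.weight, eval_finsetSum]
  | @recur k l h =>
    rintro _ ⟨t, m, E, rfl⟩
    refine goodRule_unfRule interpretsCon_interp (Nat.add_comm _ _) (fun _ => rfl)
      (fun t x z q hq => ?_) fun n => ?_
    · rw [ofFn_cons_append] at hq
      refine ⟨recFn (fun c => (h c).sem) x z, (interp_sym.1 hq).symm, ?_⟩
      rintro ⟨c, ts⟩
      rw [← List.ofFn_fin_append, ← List.ofFn_fin_append]
      exact interp_sym.2 rfl
    · simp [codeWeight, Code.weight, eval_finsetSum]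

theorem goodRule_codeGRS : ∀ ρ ∈ codeGRS e, GoodRule (interp e) (codeWeight e) ρ := by
  intro ρ hρ
  obtain ⟨d, hd⟩ := Set.mem_iUnion.1 hρ
  exact goodRule_codeRules _ _ _ ρ hd

theorem codeRules_form (a : Fin N) (b : AnyCode ar) (hb : b ∈ e.parts) :
    (∀ ρ ∈ codeRules a b hb, IsSafeUnfolding ρ) ∨
      (codeRules a b hb).Finite ∧
        ∀ ρ ∈ codeRules a b hb, IsSubgraphRule ρ ∨ IsCompositionRule ρ := by
  obtain ⟨k, l, b⟩ := b
  cases b with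
  | projNormal i =>
    refine .inr ⟨Set.finite_singleton _, ?_⟩
    rintro _ rfl
    exact .inl (isSubgraphRule_selRule (selGraph_reach_x i))
  | projSafe i =>
    refine .inr ⟨Set.finite_singleton _, ?_⟩
    rintro _ rfl
    exact .inl (isSubgraphRule_selRule (selGraph_reach_z i))
  | pred i j =>
    refine .inr ⟨Set.finite_range _, ?_⟩
    rintro _ ⟨c, rfl⟩
    refine .inl (isSubgraphRule_selRule ?_)
    split
    · exact selGraph_reach_a Nat.one_pos _
    · exact selGraph_reach_z _
  | cond =>
    refine .inr ⟨Set.finite_range _, ?_⟩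
    rintro _ ⟨c, rfl⟩
    exact .inl (isSubgraphRule_selRule (selGraph_reach_z _))
  | con c g =>
    refine .inr ⟨Set.finite_singleton _, ?_⟩
    rintro _ rfl
    exact .inr (isCompositionRule_compRule rfl rfl fun _ => rfl)
  | comp h g j =>
    refine .inr ⟨Set.finite_singleton _, ?_⟩
    rintro _ rfl
    exact .inr (isCompositionRule_compRule rfl rfl fun _ => rfl)
  | @recur k l h =>
    refine .inl ?_
    rintro _ ⟨t, m, E, rfl⟩
    refine isSafeUnfolding_unfRule (Nat.add_comm _ _) (fun _ => rfl)
      (fun c c' hc => congrArg Prod.fst hc) fun c hc => ?_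
    -- A step function cannot share its symbol with the recursion: the normal positions would force
    -- `ar c = 1` and the safe ones `ar c = 0`.
    have h1 : ar c + k = k + 1 := congrArg (fun d => (codeSig e).nrm d) hc
    have h2 : l + ar c = l := congrArg (fun d => (codeSig e).safe d) hc
    omega

/-- Only recursions have infinitely many rules, all of them unfoldings. Each of the finitely many
other symbols contributes finitely many rules. -/
theorem isSafeRecursiveGRS_codeGRS : IsSafeRecursiveGRS (codeGRS e) := by
  constructor
  · have hfin : (⋃ d : (codeSig e).D,
        {ρ ∈ codeRules d.1 d.2.1 d.2.2 | ¬ IsSafeUnfolding ρ}).Finite := by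
      have := (codeSig e).finite
      refine Set.finite_iUnion fun d => ?_
      rcases codeRules_form d.1 d.2.1 d.2.2 with h | ⟨h, _⟩
      · convert Set.finite_empty
        refine Set.eq_empty_of_forall_notMem fun ρ hρ => hρ.2 (h ρ hρ.1)
      · exact h.subset fun ρ hρ => hρ.1
    refine hfin.subset ?_
    rintro ρ ⟨hρ, hn⟩
    obtain ⟨d, hd⟩ := Set.mem_iUnion.1 hρ
    exact Set.mem_iUnion.2 ⟨d, hd, hn⟩
  · intro ρ hρ
    obtain ⟨d, hd⟩ := Set.mem_iUnion.1 hρ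
    rcases codeRules_form d.1 d.2.1 d.2.2 with h | ⟨_, h⟩
    · exact .inl (h ρ hd)
    · exact .inr (h ρ hd)

/-- Innermost safe arguments have a constructor at their root, so a predecessor or conditional rule
applies. For a recursion the rule is the one indexed by the value of the recursion argument, which
is a normal argument and therefore shared. -/
theorem hasRedexes_codeGRS : HasRedexes (interp e) (codeGRS e) := by
  rintro G α X hα hX hsh v ⟨a, ⟨⟨k, l, b⟩, hb⟩⟩ hv hcon
  suffices h : ∃ ρ ∈ codeRules a _ hb, ∃ φ : ρ.G.V → G.V, IsMatch ρ G φ by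
    obtain ⟨ρ, hρ, h⟩ := h
    exact ⟨ρ, Set.mem_iUnion.2 ⟨(a, ⟨_, hb⟩), hρ⟩, h⟩
  obtain ⟨x, z, hs⟩ : ∃ (x : Fin k → G.V) (z : Fin l → G.V),
      G.succ v = List.ofFn x ++ List.ofFn z :=
    exists_eq_append_ofFn (G.length_succ v _ hv)
  have hz : ∀ i, ∃ (c : Fin N) (us : Fin (ar c) → G.V), G.lab (z i) = some (.inl c) ∧
      G.succ (z i) = List.ofFn us := by
    intro i
    obtain ⟨c, us, h1, h2, _⟩ := hα.succ_of_con interpretsCon_interp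
      (hcon (z i) (by simp [hs]) _ .refl)
    exact ⟨c, us, h1, h2⟩
  cases b with
  | projNormal i => exact ⟨_, rfl, exists_isMatch_selRule hv hs (a := Fin.elim0) (by simp)⟩
  | projSafe i => exact ⟨_, rfl, exists_isMatch_selRule hv hs (a := Fin.elim0) (by simp)⟩
  | pred i j =>
    obtain ⟨c, us, h1, h2⟩ := hz 0
    refine ⟨_, ⟨c, rfl⟩, exists_isMatch_selRule hv hs (a := us) ?_⟩
    rintro i hi _ ⟨⟩
    obtain rfl : i = 0 := Fin.ext hi
    exact ⟨h1, h2⟩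
  | cond =>
    obtain ⟨c, us, h1, h2⟩ := hz 0
    refine ⟨_, ⟨c, rfl⟩, exists_isMatch_selRule hv hs (a := us) ?_⟩
    rintro i hi _ ⟨⟩
    obtain rfl : i = 0 := Fin.ext hi
    exact ⟨h1, h2⟩
  | con c g => exact ⟨_, rfl, exists_isMatch_compRule hv hs⟩
  | comp h g j => exact ⟨_, rfl, exists_isMatch_compRule hv hs⟩
  | @recur k l h =>
    obtain ⟨m, ⟨E⟩⟩ := SubtermEnum.exists (α (x 0))
    have hs' : G.succ v = x 0 :: (List.ofFn (Fin.tail x) ++ List.ofFn z) := by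
      rw [ofFn_cons_append, Fin.cons_self_tail, hs]
    refine ⟨_, ⟨_, m, E, rfl⟩, exists_isMatch_unfRule interpretsCon_interp hα hv hs' rfl
      (hcon _ (by simp [hs'])) (hsh _ (hX.nrm v _ ?_))⟩
    rw [LGraph.nrmSucc_of_lab _ hv, hs']
    simp [Signature.nrmAr]

end

end SafeGRS

/-! ### The corollary -/

open SafeGRS
theorem corollaryc {N : ℕ} (ar : Fin N → ℕ) (hconst : ∃ c, ar c = 0) {k l : ℕ}
    (f : (Fin k → Tm ar) → (Fin l → Tm ar) → Tm ar) (hf : GSR ar k l f) :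
    ∃ (σ : Signature ar) (S : Set (Rule σ)) (d : σ.D) (p : Polynomial ℕ),
      IsConstructorGRS S ∧ IsSafeRecursiveGRS S ∧ Defines S d f ∧
      ∀ G : TermGraph σ, G.Closed → G.Basic →
        ∀ (m : ℕ) (H : TermGraph σ), Steps S m G H → m ≤ p.eval G.normalSize := by
  obtain ⟨e, rfl⟩ := hf.exists_code
  -- Any constructor will do: it only selects a copy of the symbol for the whole code.
  obtain ⟨c, _⟩ := hconst
  let e' : AnyCode ar := ⟨k, l, e⟩
  have := (codeSig e').finite
  let _ := Fintype.ofFinite (codeSig e').D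
  -- The sum over all symbols makes one polynomial serve for basic graphs with any defined symbol at
  -- the root.
  refine ⟨codeSig e', codeGRS e', sym c e' .refl, ∑ d : (codeSig e').D, d.2.1.2.2.weight,
    fun ρ hρ => ?_, isSafeRecursiveGRS_codeGRS, ?_, fun G _ hG m H h => ?_⟩
  · have hg := goodRule_codeGRS ρ hρ
    obtain ⟨d, hd⟩ := hg.lab_left
    exact ⟨⟨_, hd, d, rfl⟩, hg.con⟩
  · exact defines_of_goodRules interpretsCon_interp goodRule_codeGRS (fun _ _ => rfl)
      (fun _ => rfl) hasRedexes_codeGRS rfl rfl fun x y => interp_sym.2 rfl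
  · refine (h.le_of_basic goodRule_codeGRS (fun _ _ => rfl) (fun _ => rfl) hG).trans ?_
    obtain ⟨_, hs, d, rfl⟩ := hG.1
    rw [hs, Polynomial.eval_finsetSum]
    exact Finset.single_le_sum
      (f := fun d : (codeSig e').D => d.2.1.2.2.weight.eval G.normalSize)
      (fun _ _ => Nat.zero_le _) (Finset.mem_univ d)
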